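/- Let $\mathbb{H}^3=\mathbb{R}^2\times(0,\infty)$ carry the hyperbolic distance $$d_{\mathbb{H}^3}(a,b)=\operatorname{arcosh}\Big(\frac{|\hat a-\hat b|^2}{2z\tilde z}+\frac12\Big(\frac{z}{\tilde z}+\frac{\tilde z}{z}\Big)\Big),\qquad a=(\hat a,z),\ b=(\hat b,\tilde z),$$ where $|\cdot|$ is the Euclidean norm of $\mathbb{R}^2$. For $a=(x,y,z)$ and $\epsilon>0$ let $B_E(\epsilon,a)$ be the open Euclidean ball of $\mathbb{R}^3$ with centre $(x,y,z\cosh\epsilon)$ and radius $z\sinh\epsilon$ (this is the hyperbolic ball of radius $\epsilon$ around $a$), and for $a\ne b$ let $C(a,b)=B_E(R,a)\cup B_E(R,b)$ with $R=d_{\mathbb{H}^3}(a,b)$. Let $\mathcal{D}\subset(0,\infty)^2$ be Borel and symmetric. Two different atoms $a,b$ of a simple, locally finite configuration $\varphi$ on $\mathbb{H}^3$, with last coordinates $z,\tilde z$, are in the relation $a\stackrel{\varphi,\mathcal{D}}{\leftrightarrow}b$ if $b$ is the unique atom of $\varphi\setminus\{a\}$ nearest to $a$ and $a$ is the unique atom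 of $\varphi\setminus\{b\}$ nearest to $b$ (both with respect to $d_{\mathbb{H}^3}$), and $(z,\tilde z)\in\mathcal{D}$. Let $\Phi$ be a homogeneous Poisson point process on $\mathbb{R}^2$ with density $\lambda\in(0,\infty)$, independently marked by marks in $(0,\infty)$ with common distribution $f(z)\,dz$, regarded as a point process on $\mathbb{H}^3$, and let $\Lambda(dx\,dy\,dz)=\lambda\,dx\,dy\,f(z)\,dz$. A two-fold Palm measure of $\Phi$ is a probability kernel $(a,b)\mapsto\mathbb{P}^{a,b}$ from $\mathbb{H}^3\times\mathbb{H}^3$ to configurations such that, for all measurable $h\ge0$, $$\mathbb{E}\sum_{a,b\in\Phi,\ a\neq b}h(a,b,\Phi)=\int\!\!\int h(a,b,\varphi)\,\mathbb{P}^{a,b}(d\varphi)\,M^{(2)}(da,db),$$ where $M^{(2)}$ is the second factorial moment measure of $\Phi$, $M^{(2)}(B)=\mathbb{E}\,\#\{(a,b)\in B: a,b\in\Phi,\ a\ne b\}$. Then, for every two-fold Palm measure of $\Phi$, $$\mathbb{P}^{a,b}\big(a\stackrel{\Phi,\mathcal{D}}{\leftrightarrow}b\big)=e^{-\Lambda(C(a,b))}\,\mathbf{1}_{\{(z,\tilde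 z)\in\mathcal{D}\}}$$ for $M^{(2)}$-almost every $(a,b)$, where $z,\tilde z$ are the last coordinates of $a,b$. Moreover, a two-fold Palm measure exists, and it can be chosen so that this equality holds for all $a\neq b$ in $\mathbb{H}^3$. -/

import Mathlib

open MeasureTheory ProbabilityTheory Set
open scoped ENNReal NNReal

noncomputable section

/-! ### The half-space model of hyperbolic 3-space -/

/-- The Euclidean plane. -/
abbrev Plane : Type := EuclideanSpace ℝ (Fin 2)

/-- The set `(0, ∞)` of marks (resources). -/
abbrev Mark : Type := Set.Ioi (0 : ℝ)

/-- The upper half-space `ℝ² × (0, ∞)`; a point is a planar position with a positive mark. -/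
abbrev HalfSpace : Type := Plane × Mark

/-- The hyperbolic distance of the upper half-space model; `dist a.1 b.1` is the Euclidean
distance of the planar positions. -/
def hypDist (a b : HalfSpace) : ℝ :=
  Real.arcosh (dist a.1 b.1 ^ 2 / (2 * (a.2 : ℝ) * (b.2 : ℝ)) +
    1 / 2 * ((a.2 : ℝ) / (b.2 : ℝ) + (b.2 : ℝ) / (a.2 : ℝ)))

/-- The open Euclidean ball of `ℝ³ = ℝ² × ℝ` with centre `(x, y, z cosh ε)` and radius
`z sinh ε`, where `a = (x, y, z)`. -/
def euclBall (ε : ℝ) (a : HalfSpace) : Set (Plane × ℝ) :=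
  {p | √(dist p.1 a.1 ^ 2 + (p.2 - (a.2 : ℝ) * Real.cosh ε) ^ 2) < (a.2 : ℝ) * Real.sinh ε}

/-- The union `C(a, b)` of the two Euclidean balls around `a` and `b` that belong to the
hyperbolic radius `hypDist a b`, as a subset of the half-space (both balls lie in it, because
`sinh ε < cosh ε`). -/
def pairRegion (a b : HalfSpace) : Set HalfSpace :=
  {p | (p.1, (p.2 : ℝ)) ∈ euclBall (hypDist a b) a ∪ euclBall (hypDist a b) b}

/-! ### Configurations of points and Poisson point processes -/

/-- Simple, locally finite configurations of points of a topological space. -/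
structure Configuration (E : Type*) [TopologicalSpace E] where
  /-- the set of atoms -/
  atoms : Set E
  locallyFinite : ∀ K : Set E, IsCompact K → (atoms ∩ K).Finite

/-- The number of atoms of a configuration in a set. -/
def Configuration.count {E : Type*} [TopologicalSpace E] (B : Set E) (φ : Configuration E) : ℕ∞ :=
  (φ.atoms ∩ B).encard

/-- The σ-algebra on configurations generated by the numbers of atoms in measurable sets. -/
instance Configuration.instMeasurableSpace {E : Type*} [TopologicalSpace E] [MeasurableSpace E] :
    MeasurableSpace (Configuration E) :=
  ⨆ (B : Set E) (_ : MeasurableSet B), MeasurableSpace.comap (Configuration.count B) ⊤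

/-- `Ψ` is a (simple) Poisson point process with intensity measure `M`. -/
structure IsPoissonProcess {Ω E : Type*} [MeasurableSpace Ω] [TopologicalSpace E]
    [MeasurableSpace E] (μ : Measure Ω) (Ψ : Ω → Configuration E) (M : Measure E) : Prop where
  measurable : Measurable Ψ
  law_count : ∀ B : Set E, MeasurableSet B → M B ≠ ∞ →
    μ.map (fun ω => (Ψ ω).count B) = (poissonMeasure (M B).toNNReal).map (Nat.cast : ℕ → ℕ∞)
  indep_count : ∀ (n : ℕ) (B : Fin n → Set E), (∀ i, MeasurableSet (B i)) →
    Pairwise (fun i j => Disjoint (B i) (B j)) →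
      iIndepFun (fun i ω => (Ψ ω).count (B i)) μ

/-- The distribution `f(z) dz` on `(0, ∞)`. -/
def markLaw (f : Mark → ℝ≥0) : Measure Mark :=
  ((volume : Measure ℝ).comap (Subtype.val : Mark → ℝ)).withDensity (fun z => (f z : ℝ≥0∞))

/-- `Φ` is a homogeneous Poisson point process of density `lam` in the plane, independently marked
with marks of distribution `f(z) dz`: its positions `X 0, X 1, …` are the distinct atoms of a
Poisson process with intensity `lam dx dy`, and the marks `Z 0, Z 1, …` attached to them are i.i.d.
with distribution `f(z) dz` and independent of the positions. -/
structure IsMarkedPoisson {Ω : Type*} [MeasurableSpace Ω] (μ : Measure Ω) (lam : ℝ≥0)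
    (f : Mark → ℝ≥0) (Φ : Ω → Configuration HalfSpace) : Prop where
  measurable : Measurable Φ
  exists_marking : ∃ (Ψ : Ω → Configuration Plane) (X : ℕ → Ω → Plane) (Z : ℕ → Ω → Mark),
    IsPoissonProcess μ Ψ (lam • (volume : Measure Plane)) ∧
    (∀ n, Measurable (X n)) ∧ (∀ n, Measurable (Z n)) ∧
    (∀ᵐ ω ∂μ, Function.Injective (fun n => X n ω)) ∧
    (∀ᵐ ω ∂μ, (Ψ ω).atoms = Set.range (fun n => X n ω)) ∧
    (∀ n, μ.map (Z n) = markLaw f) ∧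
    iIndepFun Z μ ∧
    IndepFun (fun ω n => X n ω) (fun ω n => Z n ω) μ ∧
    ∀ᵐ ω ∂μ, (Φ ω).atoms = Set.range (fun n => (X n ω, Z n ω))

/-- The measure `Λ(dx dy dz) = lam dx dy f(z) dz` on the half-space. -/
def intensity (lam : ℝ≥0) (f : Mark → ℝ≥0) : Measure HalfSpace :=
  (lam • (volume : Measure Plane)).prod (markLaw f)

/-! ### The two-fold Palm measure -/

/-- Ordered pairs of different atoms of a configuration. -/
def Configuration.pairs {E : Type*} [TopologicalSpace E] (φ : Configuration E) : Set (E × E) :=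
  {p | p.1 ∈ φ.atoms ∧ p.2 ∈ φ.atoms ∧ p.1 ≠ p.2}

/-- The second factorial moment measure
`B ↦ E[number of ordered pairs of different atoms of Φ that lie in B]`. -/
def secondFactorialMoment {Ω E : Type*} [MeasurableSpace Ω] [TopologicalSpace E]
    [MeasurableSpace E] (μ : Measure Ω) (Φ : Ω → Configuration E) : Measure (E × E) :=
  μ.bind (fun ω => Measure.sum (fun p : (Φ ω).pairs => Measure.dirac (p : E × E)))

/-- `P` is a version of the two-fold Palm measure of `Φ`: a probability kernel
`(a, b) ↦ P^{a,b}` that disintegrates the two-fold Campbell measure of `Φ` with respect to its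
second factorial moment measure. -/
def IsTwoFoldPalm {Ω E : Type*} [MeasurableSpace Ω] [TopologicalSpace E] [MeasurableSpace E]
    (μ : Measure Ω) (Φ : Ω → Configuration E) (P : Kernel (E × E) (Configuration E)) : Prop :=
  IsMarkovKernel P ∧
  ∀ h : (E × E) × Configuration E → ℝ≥0∞, Measurable h →
    ∫⁻ ω, ∑' p : (Φ ω).pairs, h ((p : E × E), Φ ω) ∂μ =
      ∫⁻ p, ∫⁻ φ, h (p, φ) ∂(P p) ∂(secondFactorialMoment μ Φ)

/-! ### The mutually nearest neighbor relation -/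

/-- `b` is the unique nearest neighbor of `a` among the other atoms of `φ`, for the hyperbolic
distance. -/
def NNR (φ : Configuration HalfSpace) (a b : HalfSpace) : Prop :=
  a ∈ φ.atoms ∧ b ∈ φ.atoms ∧ a ≠ b ∧
    ∀ c ∈ φ.atoms, c ≠ a → c ≠ b → hypDist a b < hypDist a c

/-- `a` and `b` are different atoms of `φ`, in mutually nearest neighbor relation with control
set `D`. -/
def MNNR (D : Set (Mark × Mark)) (φ : Configuration HalfSpace) (a b : HalfSpace) : Prop :=
  NNR φ a b ∧ NNR φ b a ∧ (a.2, b.2) ∈ D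

end

/-! The engine is the Mecke equation: summing over the atoms `a` of a Poisson process amounts to
integrating `a` against the intensity after adding `a` to the process. Applied twice, it shows that
the law of `Φ` with `a` and `b` added is a two-fold Palm measure and that the second factorial
moment measure is the product of `Λ` with itself (`two_fold`, `isTwoFoldPalm`). With `a` and `b`
added, the relation says that `(a.2, b.2) ∈ D` and that `Φ` has no atom other than `a`, `b` in the
two closed hyperbolic balls. Spheres and points are `Λ`-null, so this has the void probability of
`C(a, b)`. Any other Palm kernel agrees almost everywhere on this event (`IsTwoFoldPalm.ae_eq`).

The Mecke equation need only be checked on void events, a generating π-system (`isMecke_of_void`).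
For the positions it follows from independence of counts and the Poisson mean. For the marked
process, conditioning on the positions turns avoidance of `C` into a product over positions, the
exponential of an additive functional, to which the Mecke equation of the positions applies
(`IsMecke.marked`). Void probabilities are recovered from the Mecke equation alone (`measure_void`),
so the counts of the marked process are never computed directly. -/

set_option linter.unusedSectionVars false

noncomputable section

/-! ### Configurations: void events, insertion of an atom, and the kernel of atoms -/

namespace Configuration

variable {E : Type*} [TopologicalSpace E]

theorem count_eq_zero_iff {B : Set E} {φ : Configuration E} :
    φ.count B = 0 ↔ ∀ x ∈ φ.atoms, x ∉ B := by
  rw [count, encard_eq_zero, ← disjoint_iff_inter_eq_empty, disjoint_left]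

theorem count_empty (φ : Configuration E) : φ.count ∅ = 0 := by simp [count]

/-- The configuration with one more atom. -/
def insertAtom (a : E) (φ : Configuration E) : Configuration E where
  atoms := insert a φ.atoms
  locallyFinite K hK := ((φ.locallyFinite K hK).insert a).subset fun x hx => by
    rcases hx with ⟨rfl | h, hK⟩
    · exact mem_insert _ _
    · exact mem_insert_of_mem _ ⟨h, hK⟩

theorem mem_insertAtom {a x : E} {φ : Configuration E} :
    x ∈ (φ.insertAtom a).atoms ↔ x = a ∨ x ∈ φ.atoms := Iff.rfl

theorem count_insertAtom_eq_zero_iff {a : E} {B : Set E} {φ : Configuration E} :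
    (φ.insertAtom a).count B = 0 ↔ a ∉ B ∧ φ.count B = 0 := by
  simp [count_eq_zero_iff, mem_insertAtom]

theorem count_insertAtom_of_mem {a : E} {B : Set E} {φ : Configuration E} (ha : a ∈ B)
    (h : a ∉ φ.atoms) : (φ.insertAtom a).count B = φ.count B + 1 := by
  have : (φ.insertAtom a).atoms ∩ B = insert a (φ.atoms ∩ B) := by
    ext x
    simp only [mem_inter_iff, mem_insertAtom, mem_insert_iff]
    constructor
    · rintro ⟨rfl | h, h'⟩ <;> tauto
    · rintro (rfl | h) <;> tauto
  rw [count, this, encard_insert_of_notMem (fun h' => h h'.1), count]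

theorem count_ne_top_of_subset_isCompact (φ : Configuration E) {B K : Set E} (hK : IsCompact K)
    (h : B ⊆ K) : φ.count B ≠ ⊤ :=
  encard_ne_top_iff.2 ((φ.locallyFinite K hK).subset (inter_subset_inter_right _ h))

/-- Finitely many points of a Hausdorff space are separated by disjoint basic open sets. As the
basis is countable, counting reduces to countably many void events. -/
theorem le_count_iff [T2Space E] [SecondCountableTopology E] (B : Set E) (k : ℕ)
    (φ : Configuration E) :
    (k : ℕ∞) ≤ φ.count B ↔ ∃ U : Fin k → TopologicalSpace.countableBasis E,
      Pairwise (fun i j => Disjoint (U i : Set E) (U j : Set E)) ∧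
      ∀ i, φ.count (B ∩ U i) ≠ 0 := by
  constructor
  · intro h
    obtain ⟨t, ht, htk⟩ := exists_subset_encard_eq h
    have hfin : t.Finite := finite_of_encard_eq_coe htk
    obtain ⟨V, hV, hdisj⟩ := hfin.t2_separation
    have hcard : Nat.card t = k := by
      rw [Nat.card_coe_set_eq, ncard, htk, ENat.toNat_natCast]
    have : Finite t := hfin
    let e : Fin k ≃ t := (Finite.equivFinOfCardEq hcard).symm
    have hb := TopologicalSpace.isBasis_countableBasis E
    choose W hW hxW hWV using fun x => hb.exists_subset_of_mem_open (hV x).1 (hV x).2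
    refine ⟨fun i => ⟨W (e i), hW _⟩, fun i j hij => ?_, fun i => ?_⟩
    · refine (hdisj (e i).2 (e j).2 ?_).mono (hWV _) (hWV _)
      exact fun h => hij (e.injective (Subtype.ext h))
    · rw [Ne, count_eq_zero_iff]
      push Not
      exact ⟨e i, (ht (e i).2).1, (ht (e i).2).2, hxW _⟩
  · rintro ⟨U, hU, hne⟩
    have : ∀ i, ∃ x ∈ φ.atoms, x ∈ B ∩ U i := by
      intro i
      have := hne i
      rw [Ne, count_eq_zero_iff] at this
      push Not at this
      exact this
    choose x hx hxU using this
    have hinj : Function.Injective x := fun i j hij => by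
      by_contra h
      exact disjoint_left.1 (hU h) (hxU i).2 (hij ▸ (hxU j).2)
    calc (k : ℕ∞) = (range x).encard := by
          rw [← image_univ, hinj.encard_image, encard_univ]; simp
      _ ≤ _ := encard_le_encard (by rintro _ ⟨i, rfl⟩; exact ⟨hx i, (hxU i).1⟩)

/-- The events that a measurable set contains no atom. -/
def voidEvents (E : Type*) [TopologicalSpace E] [MeasurableSpace E] :
    Set (Set (Configuration E)) :=
  {S | ∃ C : Set E, MeasurableSet C ∧ S = {φ | φ.count C = 0}}

theorem isPiSystem_voidEvents [MeasurableSpace E] : IsPiSystem (voidEvents E) := by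
  rintro _ ⟨C, hC, rfl⟩ _ ⟨C', hC', rfl⟩ -
  refine ⟨C ∪ C', hC.union hC', ?_⟩
  ext φ
  simp only [mem_inter_iff, mem_ofPred_eq, count_eq_zero_iff, mem_union, not_or]
  grind

theorem measurable_count [MeasurableSpace E] {B : Set E} (hB : MeasurableSet B) :
    Measurable (count B) :=
  Measurable.of_comap_le (le_iSup₂_of_le B hB le_rfl)

theorem measurableSet_count_eq [MeasurableSpace E] {B : Set E} (hB : MeasurableSet B) (k : ℕ∞) :
    MeasurableSet {φ : Configuration E | φ.count B = k} :=
  measurable_count hB (measurableSet_singleton k)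

/-- The σ-algebra on configurations is generated by the void events. -/
theorem generateFrom_voidEvents [T2Space E] [SecondCountableTopology E] [MeasurableSpace E]
    [OpensMeasurableSpace E] :
    MeasurableSpace.generateFrom (voidEvents E) =
      (instMeasurableSpace : MeasurableSpace (Configuration E)) := by
  apply le_antisymm
  · refine MeasurableSpace.generateFrom_le ?_
    rintro _ ⟨C, hC, rfl⟩
    exact measurableSet_count_eq hC 0
  · refine iSup₂_le fun B hB => ?_
    rw [← measurable_iff_comap_le]
    have hle : ∀ k : ℕ, MeasurableSet[MeasurableSpace.generateFrom (voidEvents E)]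
        {φ : Configuration E | (k : ℕ∞) ≤ φ.count B} := by
      intro k
      simp only [le_count_iff, ofPred_exists]
      have : Countable (TopologicalSpace.countableBasis E) :=
        (TopologicalSpace.countable_countableBasis E).to_subtype
      refine MeasurableSet.iUnion fun U => ?_
      rw [ofPred_and]
      refine MeasurableSet.inter (MeasurableSet.const _) ?_
      rw [ofPred_forall]
      refine MeasurableSet.iInter fun i => ?_
      refine MeasurableSet.compl (s := {φ : Configuration E | φ.count (B ∩ U i) = 0})
        (MeasurableSpace.measurableSet_generateFrom ⟨B ∩ U i, ?_, rfl⟩)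
      exact hB.inter
        ((TopologicalSpace.isBasis_countableBasis E).isOpen (U i).2).measurableSet
    refine @measurable_to_countable' _ _ _ _ (MeasurableSpace.generateFrom (voidEvents E)) _ ?_
    intro k
    induction k using ENat.recTopCoe with
    | top =>
      have : count B ⁻¹' {⊤} = ⋂ k : ℕ, {φ : Configuration E | (k : ℕ∞) ≤ φ.count B} := by
        ext φ
        simp only [mem_preimage, mem_singleton_iff, mem_iInter, mem_ofPred_eq]
        exact ⟨fun h k => by simp [h], fun h => ENat.eq_top_iff_forall_ge.2 h⟩
      rw [this]
      exact MeasurableSet.iInter hle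
    | coe k =>
      have : count B ⁻¹' {(k : ℕ∞)} = {φ : Configuration E | (k : ℕ∞) ≤ φ.count B} \
          {φ : Configuration E | ((k + 1 : ℕ) : ℕ∞) ≤ φ.count B} := by
        ext φ
        simp only [mem_preimage, mem_singleton_iff, mem_sdiff, mem_ofPred_eq]
        cases h : count B φ with
        | top => simp
        | coe n => norm_cast; omega
      rw [this]
      exact (hle k).diff (hle (k + 1))

variable [MeasurableSpace E]

theorem measurable_of_void {α : Type*} [MeasurableSpace α] [T2Space E]
    [SecondCountableTopology E] [OpensMeasurableSpace E] {g : α → Configuration E}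
    (h : ∀ C, MeasurableSet C → MeasurableSet {x | (g x).count C = 0}) : Measurable g := by
  rw [← generateFrom_voidEvents]
  refine measurable_generateFrom ?_
  rintro _ ⟨C, hC, rfl⟩
  exact h C hC

theorem measurable_insertAtom [T2Space E] [SecondCountableTopology E] [OpensMeasurableSpace E] :
    Measurable fun p : E × Configuration E => p.2.insertAtom p.1 := by
  refine measurable_of_void fun C hC => ?_
  simp only [count_insertAtom_eq_zero_iff]
  exact (measurable_fst hC.compl).inter (measurable_snd (measurableSet_count_eq hC 0))

/-- The counting measure of the atoms. -/
def atomMeasure (φ : Configuration E) : Measure E :=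
  Measure.sum fun x : φ.atoms => Measure.dirac (x : E)

theorem atomMeasure_apply (φ : Configuration E) {B : Set E} (hB : MeasurableSet B) :
    φ.atomMeasure B = (φ.count B : ℝ≥0∞) := by
  rw [atomMeasure, Measure.sum_apply _ hB]
  simp only [Measure.dirac_apply' _ hB]
  rw [tsum_subtype φ.atoms (fun x => B.indicator (1 : E → ℝ≥0∞) x), indicator_indicator,
    ← tsum_subtype (φ.atoms ∩ B) (1 : E → ℝ≥0∞)]
  exact ENNReal.tsum_set_one _

theorem lintegral_atomMeasure (φ : Configuration E) {h : E → ℝ≥0∞} (hh : Measurable h) :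
    ∫⁻ x, h x ∂φ.atomMeasure = ∑' x : φ.atoms, h x := by
  rw [atomMeasure, lintegral_sum_measure]
  simp only [lintegral_dirac' _ hh]

/-- The atoms of a configuration, as a kernel. -/
def atomKernel (E : Type*) [TopologicalSpace E] [MeasurableSpace E] :
    Kernel (Configuration E) E where
  toFun := atomMeasure
  measurable' := by
    refine Measure.measurable_of_measurable_coe _ fun B hB => ?_
    simp only [atomMeasure_apply _ hB]
    exact (measurable_from_top (f := fun n : ℕ∞ => (n : ℝ≥0∞))).comp (measurable_count hB)

theorem atomKernel_apply (φ : Configuration E) : atomKernel E φ = φ.atomMeasure := rfl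

/-- Local finiteness gives no bound uniform in the configuration. Cutting the space into relatively
compact pieces, and the configurations by the number of atoms in a piece, leaves kernels of mass at
most `k`. -/
instance [T2Space E] [SigmaCompactSpace E] [OpensMeasurableSpace E] :
    IsSFiniteKernel (atomKernel E) := by
  let D : ℕ → Set E := disjointed (compactCovering E)
  have hD : ∀ n, MeasurableSet (D n) := fun n =>
    MeasurableSet.disjointed (fun n => (isCompact_compactCovering E n).measurableSet) n
  have hDfin : ∀ n (φ : Configuration E), φ.count (D n) ≠ ⊤ := fun n φ =>
    φ.count_ne_top_of_subset_isCompact (isCompact_compactCovering E n) (disjointed_subset _ n)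
  let κ : ℕ → ℕ → Kernel (Configuration E) E := fun n k =>
    Kernel.piecewise (measurableSet_count_eq (hD n) k) ((atomKernel E).restrict (hD n)) 0
  have hκ : ∀ n k, IsFiniteKernel (κ n k) := fun n k => by
    refine ⟨⟨k, by simp, fun φ => ?_⟩⟩
    simp only [κ, Kernel.piecewise_apply']
    split_ifs with h
    · rw [Kernel.restrict_apply' _ _ _ .univ, univ_inter, atomKernel_apply,
        atomMeasure_apply _ (hD n), h]
      simp
    · simp
  have hsum : atomKernel E = Kernel.sum fun n => Kernel.sum (κ n) := by
    ext φ B hB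
    rw [Kernel.sum_apply' _ _ hB]
    have : ∀ n, Kernel.sum (κ n) φ B = atomKernel E φ (B ∩ D n) := by
      intro n
      rw [Kernel.sum_apply' _ _ hB]
      obtain ⟨k, hk⟩ := ENat.ne_top_iff_exists.1 (hDfin n φ)
      rw [tsum_eq_single k]
      · simp [κ, Kernel.piecewise_apply', ← hk, Kernel.restrict_apply' _ _ _ hB]
      · intro j hj
        have : ¬ (k = j) := fun h => hj h.symm
        simp [κ, Kernel.piecewise_apply', ← hk, this]
    simp only [this]
    rw [← measure_iUnion]
    · rw [← inter_iUnion, iUnion_disjointed, iUnion_compactCovering, inter_univ]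
    · exact fun i j hij => ((disjoint_disjointed _ hij).mono inter_subset_right inter_subset_right)
    · exact fun n => hB.inter (hD n)
  rw [hsum]
  infer_instance

end Configuration

/-! ### The Mecke equation -/

theorem generateFrom_measure_lt_top {α : Type*} [m : MeasurableSpace α] (M : Measure α)
    [SigmaFinite M] :
    MeasurableSpace.generateFrom {A | MeasurableSet A ∧ M A < ∞} = m := by
  apply le_antisymm
  · exact MeasurableSpace.generateFrom_le fun A hA => hA.1
  · intro A hA
    rw [← inter_univ A, ← iUnion_spanningSets M, inter_iUnion]
    exact MeasurableSet.iUnion fun n => MeasurableSpace.measurableSet_generateFrom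
      ⟨hA.inter (measurableSet_spanningSets M n),
        (measure_mono inter_subset_right).trans_lt (measure_spanningSets_lt_top M n)⟩

namespace Configuration

variable {E : Type*} [TopologicalSpace E] [MeasurableSpace E]

/-- The Mecke equation with intensity measure `M` for the law `ρ` of a point process. -/
def IsMecke (M : Measure E) (ρ : Measure (Configuration E)) : Prop :=
  ∀ h : E × Configuration E → ℝ≥0∞, Measurable h →
    ∫⁻ φ, ∫⁻ a, h (a, φ) ∂φ.atomMeasure ∂ρ = ∫⁻ a, ∫⁻ φ, h (a, φ.insertAtom a) ∂ρ ∂M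

theorem measurable_lintegral_atomMeasure [T2Space E] [SigmaCompactSpace E] [BorelSpace E]
    {α : Type*} [MeasurableSpace α]
    {g : α → Configuration E} (hg : Measurable g) {h : α × E → ℝ≥0∞} (hh : Measurable h) :
    Measurable fun x => ∫⁻ a, h (x, a) ∂(g x).atomMeasure :=
  Measurable.lintegral_kernel_prod_right (κ := (atomKernel E).comap g hg) hh

variable [T2Space E] [SecondCountableTopology E] [SigmaCompactSpace E] [BorelSpace E]

/-- The Mecke equation holds if it holds for void events. -/
theorem isMecke_of_void {M : Measure E} [SigmaFinite M] {ρ : Measure (Configuration E)}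
    [IsProbabilityMeasure ρ]
    (H : ∀ A C : Set E, MeasurableSet A → MeasurableSet C → Disjoint A C → M A < ∞ →
      ∫⁻ φ in {φ | φ.count C = 0}, φ.atomMeasure A ∂ρ = M A * ρ {φ | φ.count C = 0}) :
    IsMecke M ρ := by
  have hins : Measurable fun p : E × Configuration E => (p.1, p.2.insertAtom p.1) :=
    measurable_fst.prodMk measurable_insertAtom
  let m₁ : Measure (E × Configuration E) := (ρ ⊗ₘ atomKernel E).map Prod.swap
  let m₂ : Measure (E × Configuration E) :=
    (M.prod ρ).map fun p => (p.1, p.2.insertAtom p.1)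
  let 𝒜 : Set (Set E) := {A | MeasurableSet A ∧ M A < ∞}
  -- On the void event of `C` every atom in `A` lies in `A \ C`; this is why disjoint `A` and `C`
  -- suffice in the hypothesis.
  have h₁ : ∀ A C, MeasurableSet A → MeasurableSet C → M A < ∞ →
      m₁ (A ×ˢ {φ | φ.count C = 0}) = M (A \ C) * ρ {φ | φ.count C = 0} := by
    intro A C hA hC hMA
    rw [← H (A \ C) C (hA.diff hC) hC disjoint_sdiff_left
      ((measure_mono sdiff_subset).trans_lt hMA)]
    rw [Measure.map_apply measurable_swap (hA.prod (measurableSet_count_eq hC 0)),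
      preimage_swap_prod, Measure.compProd_apply_prod (measurableSet_count_eq hC 0) hA]
    refine setLIntegral_congr_fun (measurableSet_count_eq hC 0) fun φ hφ => ?_
    rw [atomKernel_apply, atomMeasure_apply _ hA, atomMeasure_apply _ (hA.diff hC)]
    have hφ' := count_eq_zero_iff.1 hφ
    simp only [count]
    congr 2
    ext x
    exact ⟨fun h => ⟨h.1, h.2, hφ' x h.1⟩, fun h => ⟨h.1, h.2.1⟩⟩
  have h₂ : ∀ A C, MeasurableSet A → MeasurableSet C →
      m₂ (A ×ˢ {φ | φ.count C = 0}) = M (A \ C) * ρ {φ | φ.count C = 0} := by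
    intro A C hA hC
    rw [Measure.map_apply hins (hA.prod (measurableSet_count_eq hC 0)), ← Measure.prod_prod]
    congr 1
    ext ⟨a, φ⟩
    simp only [mem_preimage, mem_prod, mem_ofPred_eq, count_insertAtom_eq_zero_iff, mem_sdiff]
    tauto
  have huniv : (univ : Set (Configuration E)) = {φ | φ.count ∅ = 0} := by
    ext φ; simp [count_empty]
  have heq : m₁ = m₂ := by
    refine Measure.ext_of_generateFrom_of_iUnion (image2 (· ×ˢ ·) 𝒜 (voidEvents E))
      (fun n => spanningSets M n ×ˢ univ) ?_ ?_ ?_ ?_ ?_ ?_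
    · refine (generateFrom_eq_prod (generateFrom_measure_lt_top M) generateFrom_voidEvents
        ⟨spanningSets M, fun n => ⟨measurableSet_spanningSets M n,
          measure_spanningSets_lt_top M n⟩, iUnion_spanningSets M⟩
        ⟨fun _ => univ, fun _ => ⟨∅, .empty, huniv⟩, iUnion_const _⟩).symm
    · refine IsPiSystem.prod ?_ isPiSystem_voidEvents
      intro A hA B hB _
      exact ⟨hA.1.inter hB.1, (measure_mono inter_subset_left).trans_lt hA.2⟩
    · rw [← iUnion_prod_const, iUnion_spanningSets, univ_prod_univ]
    · exact fun n => mem_image2_of_mem ⟨measurableSet_spanningSets M n,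
        measure_spanningSets_lt_top M n⟩ ⟨∅, .empty, huniv⟩
    · intro n
      rw [huniv, h₁ _ _ (measurableSet_spanningSets M n) .empty
        (measure_spanningSets_lt_top M n), sdiff_empty]
      exact ENNReal.mul_ne_top (measure_spanningSets_lt_top M n).ne (measure_ne_top _ _)
    · rintro _ ⟨A, hA, _, ⟨C, hC, rfl⟩, rfl⟩
      exact (h₁ A C hA.1 hC hA.2).trans (h₂ A C hA.1 hC).symm
  intro h hh
  calc ∫⁻ φ, ∫⁻ a, h (a, φ) ∂φ.atomMeasure ∂ρ = ∫⁻ p, h p ∂m₁ := by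
        rw [lintegral_map hh measurable_swap,
          Measure.lintegral_compProd (f := fun p => h p.swap) (hh.comp measurable_swap)]
        rfl
    _ = ∫⁻ p, h p ∂m₂ := by rw [heq]
    _ = _ := by
        rw [lintegral_map hh hins,
          lintegral_prod (fun p : E × Configuration E => h (p.1, p.2.insertAtom p.1))
          (hh.comp hins).aemeasurable]

end Configuration

/-- The weights satisfy `(n + 1) p (n + 1) = r p n`; summing over `n` gives the mean. -/
theorem lintegral_natCast_poissonMeasure (r : ℝ≥0) :
    ∫⁻ n, (n : ℝ≥0∞) ∂poissonMeasure r = r := by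
  rw [lintegral_countable']
  have key : ∀ n : ℕ, ((n + 1 : ℕ) : ℝ≥0∞) * poissonMeasure r {n + 1} =
      r * poissonMeasure r {n} := by
    intro n
    have hreal : ((n + 1 : ℕ) : ℝ) * (Real.exp (-r) * r ^ (n + 1) / (n + 1).factorial) =
        r * (Real.exp (-r) * r ^ n / n.factorial) := by
      rw [Nat.factorial_succ]
      push_cast
      field_simp
      ring
    rw [poissonMeasure_singleton, poissonMeasure_singleton, ← ENNReal.ofReal_natCast (n + 1),
      ← ENNReal.ofReal_coe_nnreal (p := r), ← ENNReal.ofReal_mul (Nat.cast_nonneg _),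
      ← ENNReal.ofReal_mul r.coe_nonneg, hreal]
  rw [tsum_eq_zero_add' ENNReal.summable]
  simp only [key, Nat.cast_zero, zero_mul, zero_add]
  rw [ENNReal.tsum_mul_left]
  have : ∑' n, poissonMeasure r {n} = 1 := by
    rw [← measure_univ (μ := poissonMeasure r), ← lintegral_one, lintegral_countable']
    simp
  rw [this, mul_one]

namespace IsPoissonProcess

variable {Ω E : Type*} [MeasurableSpace Ω] [TopologicalSpace E] [MeasurableSpace E]
  {μ : Measure Ω} {Ψ : Ω → Configuration E} {M : Measure E}

theorem lintegral_count (h : IsPoissonProcess μ Ψ M) {A : Set E} (hA : MeasurableSet A)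
    (hMA : M A ≠ ∞) : ∫⁻ ω, ((Ψ ω).count A : ℝ≥0∞) ∂μ = M A := by
  have hm : Measurable fun ω => (Ψ ω).count A :=
    (Configuration.measurable_count hA).comp h.measurable
  rw [← lintegral_map (f := fun k : ℕ∞ => (k : ℝ≥0∞)) measurable_from_top hm,
    h.law_count A hA hMA, lintegral_map measurable_from_top measurable_from_top]
  simp only [ENat.toENNReal_coe]
  rw [lintegral_natCast_poissonMeasure, ENNReal.coe_toNNReal hMA]

/-- For disjoint `A` and `C` the counts are independent, so the expected count of `A` on the void
event of `C` factorizes. -/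
theorem isMecke [T2Space E] [SecondCountableTopology E] [SigmaCompactSpace E] [BorelSpace E]
    [IsProbabilityMeasure μ] [SigmaFinite M] (h : IsPoissonProcess μ Ψ M) :
    Configuration.IsMecke M (μ.map Ψ) := by
  have := Measure.isProbabilityMeasure_map (μ := μ) h.measurable.aemeasurable
  refine Configuration.isMecke_of_void fun A C hA hC hAC hMA => ?_
  have hΓ : MeasurableSet {φ : Configuration E | φ.count C = 0} :=
    Configuration.measurableSet_count_eq hC 0
  have hind : IndepFun (fun ω => (Ψ ω).count A) (fun ω => (Ψ ω).count C) μ := by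
    have := h.indep_count 2 ![A, C] (by simp [Fin.forall_fin_two, hA, hC]) (by
      intro i j hij
      fin_cases i <;> fin_cases j <;> simp_all [disjoint_comm])
    simpa using this.indepFun (i := 0) (j := 1) (by decide)
  simp only [Configuration.atomMeasure_apply _ hA]
  have hmA : Measurable fun φ : Configuration E => (φ.count A : ℝ≥0∞) :=
    (measurable_from_top (f := fun n : ℕ∞ => (n : ℝ≥0∞))).comp (Configuration.measurable_count hA)
  rw [← lintegral_indicator hΓ, lintegral_map (hmA.indicator hΓ) h.measurable,
    ← h.lintegral_count hA hMA.ne, Measure.map_apply h.measurable hΓ,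
    ← lintegral_indicator_one (h.measurable hΓ)]
  let u : ℕ∞ → ℝ≥0∞ := fun k => k
  let v : ℕ∞ → ℝ≥0∞ := fun k => if k = 0 then 1 else 0
  have hu : Measurable u := measurable_from_top
  have hv : Measurable v := measurable_from_top
  have := lintegral_mul_eq_lintegral_mul_lintegral_of_indepFun
    (hu.comp ((Configuration.measurable_count hA).comp h.measurable))
    (hv.comp ((Configuration.measurable_count hC).comp h.measurable)) (hind.comp hu hv)
  convert this using 1
  · refine lintegral_congr fun ω => ?_
    by_cases hω : (Ψ ω).count C = 0 <;> simp [u, v, hω, indicator]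
  · congr 1
    refine lintegral_congr fun ω => ?_
    by_cases hω : (Ψ ω).count C = 0 <;> simp [v, hω, indicator]

end IsPoissonProcess

/-! ### Void probabilities and two-fold Palm measures from the Mecke equation -/

namespace Configuration

variable {E : Type*} [TopologicalSpace E] [MeasurableSpace E]

theorem measurable_toENNReal_count {B : Set E} (hB : MeasurableSet B) :
    Measurable fun φ : Configuration E => (φ.count B : ℝ≥0∞) :=
  (measurable_from_top (f := fun n : ℕ∞ => (n : ℝ≥0∞))).comp (measurable_count hB)

/-- As `g` vanishes at `a`, it is irrelevant whether `a` was already an atom. -/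
theorem lintegral_atomMeasure_insertAtom {a : E} {φ : Configuration E} {g : E → ℝ≥0∞}
    (hg : Measurable g) (ha : g a = 0) :
    ∫⁻ x, g x ∂(φ.insertAtom a).atomMeasure = ∫⁻ x, g x ∂φ.atomMeasure := by
  rw [lintegral_atomMeasure _ hg, lintegral_atomMeasure _ hg, tsum_subtype, tsum_subtype]
  congr 1
  ext x
  by_cases hx : x = a
  · subst hx
    simp [indicator, ha]
  · have hiff : x ∈ (φ.insertAtom a).atoms ↔ x ∈ φ.atoms := by simp [mem_insertAtom, hx]
    by_cases hm : x ∈ φ.atoms <;> simp [indicator, hiff, hm]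

/-- A sum over ordered pairs of different atoms as an iterated integral. -/
theorem tsum_pairs [MeasurableEq E] (φ : Configuration E) {g : E × E → ℝ≥0∞}
    (hg : Measurable g) :
    ∑' p : φ.pairs, g p =
      ∫⁻ a, ∫⁻ b, (diagonal E)ᶜ.indicator g (a, b) ∂φ.atomMeasure ∂φ.atomMeasure := by
  have hind : Measurable ((diagonal E)ᶜ.indicator g) :=
    hg.indicator measurableSet_diagonal.compl
  have hsum : ∀ a, ∫⁻ b, (diagonal E)ᶜ.indicator g (a, b) ∂φ.atomMeasure =
      ∑' b : φ.atoms, (diagonal E)ᶜ.indicator g (a, b) := fun a =>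
    lintegral_atomMeasure φ (hind.comp measurable_prodMk_left)
  simp only [hsum]
  rw [atomMeasure, lintegral_sum_measure]
  simp only [lintegral_dirac]
  rw [tsum_subtype φ.pairs g,
    tsum_subtype φ.atoms fun a => ∑' b : φ.atoms, (diagonal E)ᶜ.indicator g (a, (b : E))]
  refine (ENNReal.tsum_prod (f := fun a b => φ.pairs.indicator g (a, b))).trans ?_
  refine tsum_congr fun a => ?_
  by_cases ha : a ∈ φ.atoms
  · rw [indicator_of_mem ha, tsum_subtype φ.atoms fun b => (diagonal E)ᶜ.indicator g (a, b)]
    refine tsum_congr fun b => ?_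
    by_cases hb : b ∈ φ.atoms <;> by_cases hab : a = b <;>
      simp [indicator, pairs, ha, hb, hab]
  · rw [indicator_of_notMem ha]
    simp [indicator, pairs, ha]

variable [T2Space E] [SecondCountableTopology E] [SigmaCompactSpace E] [BorelSpace E]

theorem measurable_lintegral_lintegral_offDiag {h : (E × E) × Configuration E → ℝ≥0∞}
    (hh : Measurable h) : Measurable fun q : E × Configuration E =>
      ∫⁻ b, (diagonal E)ᶜ.indicator (fun p => h (p, q.2)) (q.1, b) ∂q.2.atomMeasure := by
  have : Measurable fun x : (E × Configuration E) × E =>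
      ((Prod.fst ⁻¹' (diagonal E)ᶜ).indicator h) ((x.1.1, x.2), x.1.2) :=
    (hh.indicator (measurable_fst measurableSet_diagonal.compl)).comp (by fun_prop)
  exact measurable_lintegral_atomMeasure measurable_snd (h := fun x => (diagonal E)ᶜ.indicator
    (fun p => h (p, x.1.2)) (x.1.1, x.2)) this

theorem measurable_tsum_pairs {h : (E × E) × Configuration E → ℝ≥0∞} (hh : Measurable h) :
    Measurable fun φ : Configuration E => ∑' p : φ.pairs, h ((p : E × E), φ) := by
  have : ∀ φ : Configuration E, ∑' p : φ.pairs, h ((p : E × E), φ) = _ :=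
    fun φ => tsum_pairs φ (hh.comp measurable_prodMk_right)
  simp only [this]
  exact measurable_lintegral_atomMeasure measurable_id
    ((measurable_lintegral_lintegral_offDiag hh).comp measurable_swap)

variable {M : Measure E} {ρ : Measure (Configuration E)}

namespace IsMecke

/-- By the Mecke equation the expected number of atoms at `a` is `M {a} = 0`. Hence inserting `a`
almost surely adds a new atom. -/
theorem ae_notMem [NullSingletonClass M] [IsProbabilityMeasure ρ] (H : IsMecke M ρ) (a : E) :
    ∀ᵐ φ ∂ρ, a ∉ φ.atoms := by
  have hm : Measurable fun q : E × Configuration E => ({a} : Set E).indicator (1 : E → ℝ≥0∞) q.1 :=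
    (measurable_one.indicator (measurableSet_singleton a)).comp measurable_fst
  have h := H _ hm
  simp only [lintegral_indicator_one (measurableSet_singleton a), lintegral_const,
    measure_univ, mul_one, measure_singleton] at h
  simp only [atomMeasure_apply _ (measurableSet_singleton a)] at h
  rw [lintegral_eq_zero_iff (measurable_toENNReal_count (measurableSet_singleton a))] at h
  filter_upwards [h] with φ hφ
  have : φ.count {a} = 0 := by simpa using hφ
  exact fun ha => count_eq_zero_iff.1 this a ha rfl

theorem ae_count_ne_top [IsProbabilityMeasure ρ] (H : IsMecke M ρ) {C : Set E}
    (hC : MeasurableSet C) (hMC : M C ≠ ∞) : ∀ᵐ φ ∂ρ, φ.count C ≠ ⊤ := by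
  have hm : Measurable fun q : E × Configuration E => C.indicator (1 : E → ℝ≥0∞) q.1 :=
    (measurable_one.indicator hC).comp measurable_fst
  have h := H _ hm
  simp only [lintegral_indicator_one hC, lintegral_const,
    measure_univ, mul_one, atomMeasure_apply _ hC] at h
  have := ae_lt_top (measurable_toENNReal_count hC) (h.trans_ne hMC)
  filter_upwards [this] with φ hφ h
  simp [h] at hφ

/-- The Mecke equation is tested on `a ∈ C` and count `k + 1`: the atom sum contributes the factor
`k + 1`, while on the other side the inserted point accounts for one of the atoms. -/
theorem succ_mul_measure_count_eq [NullSingletonClass M] [IsProbabilityMeasure ρ] (H : IsMecke M ρ)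
    {C : Set E} (hC : MeasurableSet C) (k : ℕ) :
    (k + 1 : ℝ≥0∞) * ρ {φ | φ.count C = (k + 1 : ℕ)} = M C * ρ {φ | φ.count C = k} := by
  obtain ⟨K, hK⟩ : ∃ K : ℕ∞, K = (k + 1 : ℕ) := ⟨_, rfl⟩
  have hK' : (K : ℝ≥0∞) = k + 1 := by simp [hK]
  rw [← hK]
  have hk : MeasurableSet {φ : Configuration E | φ.count C = K} :=
    measurableSet_count_eq hC _
  have h := H ((C ×ˢ {φ : Configuration E | φ.count C = K}).indicator 1)
    (measurable_one.indicator (hC.prod hk))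
  have hl : ∀ φ : Configuration E,
      ∫⁻ a, (C ×ˢ {φ : Configuration E | φ.count C = K}).indicator 1 (a, φ)
        ∂φ.atomMeasure =
      {φ : Configuration E | φ.count C = K}.indicator (fun _ => (k + 1 : ℝ≥0∞)) φ := by
    intro φ
    by_cases hφ : φ.count C = K
    · have : ∀ a, (C ×ˢ {φ : Configuration E | φ.count C = K}).indicator
          (1 : E × Configuration E → ℝ≥0∞) (a, φ) = C.indicator 1 a := by
        intro a
        by_cases ha : a ∈ C <;> simp [indicator, ha, hφ]
      simp only [this]
      rw [lintegral_indicator_one hC, atomMeasure_apply _ hC, indicator_of_mem (by exact hφ), hφ,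
        hK']
    · simp [indicator, hφ]
  have hr : ∀ a, ∫⁻ φ, (C ×ˢ {φ : Configuration E | φ.count C = K}).indicator 1
      (a, φ.insertAtom a) ∂ρ = C.indicator (fun _ => ρ {φ | φ.count C = k}) a := by
    intro a
    by_cases ha : a ∈ C
    · rw [indicator_of_mem ha, ← lintegral_indicator_one (measurableSet_count_eq hC _)]
      refine lintegral_congr_ae ?_
      filter_upwards [H.ae_notMem a] with φ hφ
      have hc : (φ.insertAtom a).count C = K ↔ φ.count C = k := by
        rw [count_insertAtom_of_mem ha hφ, hK]
        cases φ.count C with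
        | top =>
          rw [top_add]
          exact iff_of_false (ENat.top_ne_natCast _) (ENat.top_ne_natCast _)
        | coe n => norm_cast; omega
      by_cases h' : φ.count C = k <;> simp [indicator, ha, hc, h']
    · simp [indicator, ha]
  simp only [hl, hr] at h
  rwa [lintegral_indicator_const hk, lintegral_indicator_const hC, mul_comm (ρ _)] at h

/-- The void probabilities of a process that satisfies the Mecke equation. -/
theorem measure_void [NullSingletonClass M] [IsProbabilityMeasure ρ] (H : IsMecke M ρ) {C : Set E}
    (hC : MeasurableSet C) (hMC : M C ≠ ∞) :
    ρ {φ | φ.count C = 0} = ENNReal.ofReal (Real.exp (-(M C).toReal)) := by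
  set r : ℝ≥0 := (M C).toNNReal with hr
  let q : ℕ → ℝ := fun k => ρ.real {φ | φ.count C = k}
  -- The recursion makes `q` a multiple of the Poisson weights; total mass one then fixes the
  -- multiple.
  have hq : ∀ k, q k = (q 0 * Real.exp r) * (Real.exp (-r) * r ^ k / k.factorial) := by
    intro k
    induction k with
    | zero =>
      rw [Real.exp_neg]
      have := (Real.exp_pos r).ne'
      field_simp
      simp
    | succ k ih =>
      have h := congrArg ENNReal.toReal (H.succ_mul_measure_count_eq hC k)
      rw [ENNReal.toReal_mul, ENNReal.toReal_mul] at h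
      have h' : ((k : ℝ) + 1) * q (k + 1) = r * q k := by
        rw [ENNReal.toReal_add (by simp) (by simp)] at h
        exact h
      have hk : ((k : ℝ) + 1) ≠ 0 := by positivity
      apply mul_left_cancel₀ hk
      rw [h', ih, Nat.factorial_succ]
      push_cast
      field_simp
      ring
  -- No mass escapes to the value `⊤`, because the count has finite mean `M C`.
  have hsum : HasSum q 1 := by
    have hU : ρ (⋃ k : ℕ, {φ : Configuration E | φ.count C = k}) = 1 := by
      rw [← measure_univ (μ := ρ)]
      refine measure_congr ?_
      filter_upwards [H.ae_count_ne_top hC hMC] with φ hφ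
      obtain ⟨k, hk⟩ := ENat.ne_top_iff_exists.1 hφ
      apply propext
      exact ⟨fun _ => trivial, fun _ => mem_iUnion.2 ⟨k, hk.symm⟩⟩
    rw [measure_iUnion] at hU
    · have := (ENNReal.hasSum_toReal (f := fun k : ℕ => ρ {φ : Configuration E | φ.count C = k})
        (by rw [hU]; simp))
      rw [← ENNReal.tsum_toReal_eq (fun _ => measure_ne_top _ _), hU] at this
      exact this
    · intro i j hij
      rw [Function.onFun, disjoint_left]
      intro φ hi hj
      exact hij (by exact_mod_cast (show (φ.count C) = i from hi).symm.trans hj)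
    · exact fun k => measurableSet_count_eq hC _
  have h1 : q 0 * Real.exp r = 1 := by
    have := (hasSum_one_poissonMeasure r).mul_left (q 0 * Real.exp r)
    simp only [← hq, mul_one] at this
    exact this.unique hsum
  have h0 : q 0 = Real.exp (-r) := by
    rw [Real.exp_neg]
    exact eq_inv_of_mul_eq_one_left h1
  have : ρ {φ | φ.count C = 0} = ENNReal.ofReal (q 0) := by
    simp [q, ofReal_measureReal]
  rw [this, h0]
  rfl

/-- The two-fold Mecke equation. -/
theorem two_fold [NullSingletonClass M] (H : IsMecke M ρ) {h : (E × E) × Configuration E → ℝ≥0∞}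
    (hh : Measurable h) :
    ∫⁻ φ, ∑' p : φ.pairs, h ((p : E × E), φ) ∂ρ =
      ∫⁻ a, ∫⁻ b, ∫⁻ φ, h ((a, b), (φ.insertAtom b).insertAtom a) ∂ρ ∂M ∂M := by
  have hsum : ∀ φ : Configuration E, ∑' p : φ.pairs, h ((p : E × E), φ) = _ :=
    fun φ => tsum_pairs φ (hh.comp measurable_prodMk_right)
  simp only [hsum]
  refine (H _ (measurable_lintegral_lintegral_offDiag hh)).trans ?_
  refine lintegral_congr fun a => ?_
  have hins : Measurable fun φ : Configuration E => φ.insertAtom a :=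
    measurable_insertAtom.comp measurable_prodMk_left
  -- The point `a` from the first application is frozen, and the Mecke equation is applied again in
  -- the second point. The diagonal indicator makes the inserted `a` invisible to the inner sum.
  let g : E × Configuration E → ℝ≥0∞ := fun q =>
    (diagonal E)ᶜ.indicator (fun p => h (p, q.2.insertAtom a)) (a, q.1)
  have hg : Measurable g := by
    have : Measurable fun x : E × Configuration E =>
        ((Prod.fst ⁻¹' (diagonal E)ᶜ).indicator h) ((a, x.1), x.2.insertAtom a) :=
      (hh.indicator (measurable_fst measurableSet_diagonal.compl)).comp
        ((measurable_const.prodMk measurable_fst).prodMk (hins.comp measurable_snd))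
    exact this
  calc _ = ∫⁻ φ, ∫⁻ b, g (b, φ) ∂φ.atomMeasure ∂ρ := by
        refine lintegral_congr fun φ => ?_
        exact lintegral_atomMeasure_insertAtom (g := fun b => g (b, φ))
          (hg.comp measurable_prodMk_right) (by simp [g])
    _ = ∫⁻ b, ∫⁻ φ, g (b, φ.insertAtom b) ∂ρ ∂M := H g hg
    _ = _ := by
        refine lintegral_congr_ae ?_
        -- The diagonal indicator can be dropped again because `M` has no atoms.
        have : ∀ᵐ b ∂M, b ≠ a := by simp [ae_iff]
        filter_upwards [this] with b hb
        refine lintegral_congr fun φ => ?_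
        simp [g, indicator, hb.symm]

end IsMecke

/-- The law of a process with two more atoms, as a kernel. -/
def twoFoldKernel (ρ : Measure (Configuration E)) [SFinite ρ] :
    Kernel (E × E) (Configuration E) where
  toFun p := ρ.map fun φ => (φ.insertAtom p.2).insertAtom p.1
  measurable' := by
    have hins : Measurable fun q : (E × E) × Configuration E =>
        (q.2.insertAtom q.1.2).insertAtom q.1.1 :=
      measurable_insertAtom.comp (measurable_fst.fst.prodMk
        (measurable_insertAtom.comp (measurable_fst.snd.prodMk measurable_snd)))
    refine Measure.measurable_of_measurable_coe _ fun S hS => ?_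
    have : ∀ p : E × E, (ρ.map fun φ => (φ.insertAtom p.2).insertAtom p.1) S =
        ρ (Prod.mk p ⁻¹' ((fun q : (E × E) × Configuration E =>
          (q.2.insertAtom q.1.2).insertAtom q.1.1) ⁻¹' S)) := fun p =>
      Measure.map_apply (hins.comp measurable_prodMk_left) hS
    simp only [this]
    exact measurable_measure_prodMk_left (hins hS)

theorem measurable_insertAtom_insertAtom (a b : E) :
    Measurable fun φ : Configuration E => (φ.insertAtom b).insertAtom a :=
  (measurable_insertAtom.comp measurable_prodMk_left).comp
    (measurable_insertAtom.comp measurable_prodMk_left)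

theorem twoFoldKernel_apply [SFinite ρ] (a b : E) :
    twoFoldKernel ρ (a, b) = ρ.map fun φ => (φ.insertAtom b).insertAtom a := rfl

instance [IsProbabilityMeasure ρ] : IsMarkovKernel (twoFoldKernel ρ) :=
  ⟨fun p => Measure.isProbabilityMeasure_map
    (measurable_insertAtom_insertAtom p.1 p.2).aemeasurable⟩

variable {Ω : Type*} [MeasurableSpace Ω] {μ : Measure Ω} [IsProbabilityMeasure μ]
  {Φ : Ω → Configuration E}

/-- This is the two-fold Mecke equation for test functions of the pair alone. -/
theorem IsMecke.secondFactorialMoment_eq [SFinite M] [NullSingletonClass M] (hΦ : Measurable Φ)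
    (H : IsMecke M (μ.map Φ)) : secondFactorialMoment μ Φ = M.prod M := by
  have := Measure.isProbabilityMeasure_map (μ := μ) hΦ.aemeasurable
  have key : ∀ B : Set (E × E), MeasurableSet B → ∀ φ : Configuration E,
      Measure.sum (fun p : φ.pairs => Measure.dirac (p : E × E)) B =
        ∑' p : φ.pairs, (fun x : (E × E) × Configuration E => B.indicator 1 x.1) (p, φ) := by
    intro B hB φ
    rw [Measure.sum_apply _ hB]
    simp only [Measure.dirac_apply' _ hB]
  have hm : ∀ B : Set (E × E), MeasurableSet B →
      Measurable fun x : (E × E) × Configuration E => B.indicator (1 : E × E → ℝ≥0∞) x.1 :=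
    fun B hB => (measurable_one.indicator hB).comp measurable_fst
  have hmeas : Measurable fun φ : Configuration E =>
      Measure.sum (fun p : φ.pairs => Measure.dirac (p : E × E)) := by
    refine Measure.measurable_of_measurable_coe _ fun B hB => ?_
    simp only [key B hB]
    exact measurable_tsum_pairs (hm B hB)
  ext B hB
  refine (Measure.bind_apply hB (hmeas.comp hΦ).aemeasurable).trans ?_
  simp only [Function.comp_apply]
  rw [← lintegral_map (f := fun φ : Configuration E =>
      Measure.sum (fun p : φ.pairs => Measure.dirac (p : E × E)) B)
      ((Measure.measurable_coe hB).comp hmeas) hΦ]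
  simp only [key B hB]
  rw [H.two_fold (hm B hB), ← lintegral_indicator_one hB,
    lintegral_prod _ (measurable_one.indicator hB).aemeasurable]
  simp

/-- Once the second factorial moment measure is known to be `M.prod M`, the two-fold Mecke equation
is exactly the required disintegration. -/
theorem IsMecke.isTwoFoldPalm [SFinite M] [NullSingletonClass M] (hΦ : Measurable Φ)
    (H : IsMecke M (μ.map Φ)) : IsTwoFoldPalm μ Φ (twoFoldKernel (μ.map Φ)) := by
  have := Measure.isProbabilityMeasure_map (μ := μ) hΦ.aemeasurable
  refine ⟨inferInstance, fun h hh => ?_⟩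
  rw [← lintegral_map (f := fun φ : Configuration E => ∑' p : φ.pairs, h ((p : E × E), φ))
    (measurable_tsum_pairs hh) hΦ, H.two_fold hh, H.secondFactorialMoment_eq hΦ,
    lintegral_prod _ hh.lintegral_kernel_prod_right'.aemeasurable]
  refine lintegral_congr fun a => lintegral_congr fun b => ?_
  rw [twoFoldKernel_apply, lintegral_map (f := fun φ => h ((a, b), φ))
    (hh.comp measurable_prodMk_left)
    (measurable_insertAtom_insertAtom a b)]

end Configuration

/-- Two versions of the two-fold Palm measure agree almost everywhere on the sections of a
measurable set. -/
theorem IsTwoFoldPalm.ae_eq {Ω E : Type*} [MeasurableSpace Ω] [TopologicalSpace E]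
    [MeasurableSpace E] {μ : Measure Ω} {Φ : Ω → Configuration E}
    [SigmaFinite (secondFactorialMoment μ Φ)] {P Q : Kernel (E × E) (Configuration E)}
    (hP : IsTwoFoldPalm μ Φ P) (hQ : IsTwoFoldPalm μ Φ Q)
    {S : Set ((E × E) × Configuration E)} (hS : MeasurableSet S) :
    ∀ᵐ p ∂secondFactorialMoment μ Φ, P p (Prod.mk p ⁻¹' S) = Q p (Prod.mk p ⁻¹' S) := by
  have := hP.1
  have := hQ.1
  -- Only one jointly measurable `S` is tested, so equality of integrals over all measurable `B`
  -- suffices; both equal the Campbell integral of the indicator of `p ∈ B` and `(p, φ) ∈ S`.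
  refine ae_eq_of_forall_setLIntegral_eq_of_sigmaFinite
    (Kernel.measurable_kernel_prodMk_left hS) (Kernel.measurable_kernel_prodMk_left hS) ?_
  intro B hB _
  have key : ∀ R : Kernel (E × E) (Configuration E),
      ∫⁻ p, ∫⁻ φ, (Prod.fst ⁻¹' B ∩ S).indicator 1 (p, φ) ∂(R p) 
        ∂(secondFactorialMoment μ Φ) =
      ∫⁻ p in B, R p (Prod.mk p ⁻¹' S) ∂secondFactorialMoment μ Φ := by
    intro R
    rw [← lintegral_indicator hB]
    refine lintegral_congr fun p => ?_
    by_cases hp : p ∈ B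
    · rw [indicator_of_mem hp, ← lintegral_indicator_one (measurable_prodMk_left hS)]
      refine lintegral_congr fun φ => ?_
      by_cases h : (p, φ) ∈ S <;> simp [indicator, hp, h]
    · simp [indicator, hp]
  have hm : Measurable ((Prod.fst ⁻¹' B ∩ S).indicator (1 : (E × E) × Configuration E → ℝ≥0∞)) :=
    measurable_one.indicator ((measurable_fst hB).inter hS)
  rw [← key, ← key, ← hP.2 _ hm, ← hQ.2 _ hm]

/-! ### Independent marking preserves the Mecke equation -/

/-- The decreasing exponential `t ↦ e^{-t}` on `[0, ∞]`. -/
def expNeg (t : ℝ≥0∞) : ℝ≥0∞ := EReal.exp (-(t : EReal))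

/-- The inverse `p ↦ -log p` of `expNeg` on `[0, 1]`. -/
def negLog (p : ℝ≥0∞) : ℝ≥0∞ := (-ENNReal.log p).toENNReal

theorem continuous_expNeg : Continuous expNeg :=
  ENNReal.continuous_exp.comp (continuous_neg.comp continuous_coe_ennreal_ereal)

theorem measurable_expNeg : Measurable expNeg := continuous_expNeg.measurable

theorem measurable_negLog : Measurable negLog :=
  ENNReal.measurable_log.neg.ereal_toENNReal

theorem expNeg_negLog {p : ℝ≥0∞} (hp : p ≤ 1) : expNeg (negLog p) = p := by
  have : (0 : EReal) ≤ -ENNReal.log p := by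
    rw [EReal.le_neg, neg_zero]
    exact ENNReal.log_le_zero_iff.2 hp
  rw [expNeg, negLog, EReal.coe_toENNReal this, neg_neg, ENNReal.exp_log]

theorem expNeg_zero : expNeg 0 = 1 := by simp [expNeg]

theorem expNeg_add (s t : ℝ≥0∞) : expNeg (s + t) = expNeg s * expNeg t := by
  rw [expNeg, expNeg, expNeg, ← EReal.exp_add, EReal.coe_ennreal_add, EReal.neg_add, sub_eq_add_neg]
  · exact Or.inl (EReal.coe_ennreal_ne_bot _)
  · exact Or.inr (EReal.coe_ennreal_ne_bot _)

theorem expNeg_sum {ι : Type*} (s : Finset ι) (f : ι → ℝ≥0∞) :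
    expNeg (∑ i ∈ s, f i) = ∏ i ∈ s, expNeg (f i) := by
  classical
  induction s using Finset.induction_on with
  | empty => simp [expNeg_zero]
  | insert a s ha ih => rw [Finset.sum_insert ha, Finset.prod_insert ha, expNeg_add, ih]

/-- Continuity on all of `[0, ∞]` passes from finite sums to the limit; vanishing factors and
divergent sums are covered by `expNeg ∞ = 0`. -/
theorem expNeg_tsum {ι : Type*} (f : ι → ℝ≥0∞) : expNeg (∑' i, f i) = ∏' i, expNeg (f i) := by
  have h : HasProd (fun i => expNeg (f i)) (expNeg (∑' i, f i)) := by
    have := (continuous_expNeg.tendsto _).comp (ENNReal.summable (f := f)).hasSum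
    simpa only [HasProd, Function.comp_def, expNeg_sum] using this
  exact h.tprod_eq.symm

/-- This rewrites a product over an enumeration of atoms as a function of an integral against the
atom measure, which no longer involves the enumeration. -/
theorem tprod_eq_expNeg {ι : Type*} {f : ι → ℝ≥0∞} (hf : ∀ i, f i ≤ 1) :
    ∏' i, f i = expNeg (∑' i, negLog (f i)) := by
  rw [expNeg_tsum]
  exact tprod_congr fun i => (expNeg_negLog (hf i)).symm

namespace Configuration

theorem lintegral_atomMeasure_of_range {E ι : Type*} [TopologicalSpace E] [MeasurableSpace E]
    {φ : Configuration E} {x : ι → E} (hx : Function.Injective x) (hφ : φ.atoms = range x)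
    {h : E → ℝ≥0∞} (hh : Measurable h) : ∫⁻ y, h y ∂φ.atomMeasure = ∑' i, h (x i) := by
  rw [lintegral_atomMeasure _ hh, hφ, tsum_range h hx]

end Configuration

/-- The probability that all marked points lie in given sets. -/
theorem measure_forall_marked_mem {Ω E F : Type*} [MeasurableSpace Ω] [MeasurableSpace E]
    [MeasurableSpace F] {μ : Measure Ω} [IsProbabilityMeasure μ] {ν : Measure F}
    [IsProbabilityMeasure ν] {X : ℕ → Ω → E} {Z : ℕ → Ω → F} (hX : ∀ n, Measurable (X n))
    (hZ : ∀ n, Measurable (Z n)) (hν : ∀ n, μ.map (Z n) = ν) (hind : iIndepFun Z μ)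
    (hXZ : IndepFun (fun ω n => X n ω) (fun ω n => Z n ω) μ) {T : ℕ → Set (E × F)}
    (hT : ∀ n, MeasurableSet (T n)) :
    μ {ω | ∀ n, (X n ω, Z n ω) ∈ T n} = ∫⁻ ω, ∏' n, ν (Prod.mk (X n ω) ⁻¹' T n) ∂μ := by
  have hX' : Measurable fun ω n => X n ω := measurable_pi_iff.2 hX
  have hZ' : Measurable fun ω n => Z n ω := measurable_pi_iff.2 hZ
  let U : Set ((ℕ → E) × (ℕ → F)) := {p | ∀ n, (p.1 n, p.2 n) ∈ T n}
  have hU : MeasurableSet U := by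
    have : U = ⋂ n, (fun p : (ℕ → E) × (ℕ → F) => (p.1 n, p.2 n)) ⁻¹' T n := by
      ext p; simp [U]
    rw [this]
    exact MeasurableSet.iInter fun n => (by fun_prop : Measurable _) (hT n)
  -- The joint law of positions and marks is a product whose mark factor is an infinite product of
  -- copies of `ν`, so Fubini conditions on the positions.
  have hlaw := (indepFun_iff_map_prod_eq_prod_map_map hX'.aemeasurable hZ'.aemeasurable).1 hXZ
  rw [hind.map_fun_eq_infinitePi_map hZ] at hlaw
  simp only [hν] at hlaw
  have hsec : ∀ x : ℕ → E, Measure.infinitePi (fun _ : ℕ => ν) (Prod.mk x ⁻¹' U) =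
      ∏' n, ν (Prod.mk (x n) ⁻¹' T n) := by
    intro x
    rw [← Measure.infinitePi_pi_univ _ fun n => measurable_prodMk_left (hT n)]
    congr 1
    ext z
    simp [U]
  calc μ {ω | ∀ n, (X n ω, Z n ω) ∈ T n} =
        μ.map (fun ω => ((fun n => X n ω), fun n => Z n ω)) U :=
        (Measure.map_apply (hX'.prodMk hZ') hU).symm
    _ = ∫⁻ x, Measure.infinitePi (fun _ : ℕ => ν) (Prod.mk x ⁻¹' U)
          ∂(μ.map fun ω n => X n ω) := by rw [hlaw, Measure.prod_apply hU]
    _ = _ := by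
        rw [lintegral_map (measurable_measure_prodMk_left hU) hX']
        simp only [hsec]

namespace Configuration

/-- A process that satisfies the Mecke equation, with independent marks of law `ν`, satisfies the
Mecke equation for the product intensity. -/
theorem IsMecke.marked {Ω E F : Type*} [MeasurableSpace Ω] [TopologicalSpace E]
    [MeasurableSpace E] [T2Space E] [SecondCountableTopology E] [SigmaCompactSpace E]
    [BorelSpace E] [TopologicalSpace F] [MeasurableSpace F] [T2Space F]
    [SecondCountableTopology F] [SigmaCompactSpace F] [BorelSpace F]
    {μ : Measure Ω} [IsProbabilityMeasure μ] {M : Measure E} [SigmaFinite M]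
    [NullSingletonClass M] {ν : Measure F} [IsProbabilityMeasure ν]
    {Ψ : Ω → Configuration E} {Φ : Ω → Configuration (E × F)}
    {X : ℕ → Ω → E} {Z : ℕ → Ω → F} (hΨ : Measurable Ψ) (hΦ : Measurable Φ)
    (H : IsMecke M (μ.map Ψ)) (hX : ∀ n, Measurable (X n)) (hZ : ∀ n, Measurable (Z n))
    (hinj : ∀ᵐ ω ∂μ, Function.Injective fun n => X n ω)
    (hΨX : ∀ᵐ ω ∂μ, (Ψ ω).atoms = range fun n => X n ω)
    (hν : ∀ n, μ.map (Z n) = ν) (hind : iIndepFun Z μ)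
    (hXZ : IndepFun (fun ω n => X n ω) (fun ω n => Z n ω) μ)
    (hΦXZ : ∀ᵐ ω ∂μ, (Φ ω).atoms = range fun n => (X n ω, Z n ω)) :
    IsMecke (M.prod ν) (μ.map Φ) := by
  have := Measure.isProbabilityMeasure_map (μ := μ) hΦ.aemeasurable
  have := Measure.isProbabilityMeasure_map (μ := μ) hΨ.aemeasurable
  refine isMecke_of_void fun A C hA hC hAC _ => ?_
  have hΓ : MeasurableSet {φ : Configuration (E × F) | φ.count C = 0} :=
    measurableSet_count_eq hC 0
  let q : E → ℝ≥0∞ := fun x => ν (Prod.mk x ⁻¹' A)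
  let l : E → ℝ≥0∞ := fun x => negLog (ν (Prod.mk x ⁻¹' Cᶜ))
  have hq : Measurable q := measurable_measure_prodMk_left hA
  have hl : Measurable l := measurable_negLog.comp (measurable_measure_prodMk_left hC.compl)
  let G : Configuration E → ℝ≥0∞ := fun ψ => expNeg (∫⁻ y, l y ∂ψ.atomMeasure)
  have hG : Measurable G := measurable_expNeg.comp
    (measurable_lintegral_atomMeasure measurable_id (hl.comp measurable_snd))
  -- The conditional probability that the atom at `p.1` has its mark in the section of `A` while all
  -- other atoms avoid `C`. The atom `p.1` is left out of the integral since its own factor is `q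
  -- p.1`.
  let g : E × Configuration E → ℝ≥0∞ := fun p =>
    q p.1 * expNeg (∫⁻ y, ({p.1}ᶜ : Set E).indicator l y ∂p.2.atomMeasure)
  have hg : Measurable g := by
    refine (hq.comp measurable_fst).mul (measurable_expNeg.comp ?_)
    have : Measurable fun x : (E × Configuration E) × E =>
        ((diagonal E)ᶜ.indicator fun y : E × E => l y.2) (x.1.1, x.2) :=
      ((hl.comp measurable_snd).indicator measurableSet_diagonal.compl).comp (by fun_prop)
    refine measurable_lintegral_atomMeasure measurable_snd
      (h := fun x : (E × Configuration E) × E => ({x.1.1}ᶜ : Set E).indicator l x.2) ?_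
    convert this using 2 with x
    by_cases hx : x.1.1 = x.2 <;> simp [indicator, hx, eq_comm]
  have hvoid : μ.map Φ {φ | φ.count C = 0} = ∫⁻ ψ, G ψ ∂(μ.map Ψ) := by
    rw [Measure.map_apply hΦ hΓ, lintegral_map hG hΨ]
    calc μ (Φ ⁻¹' {φ | φ.count C = 0}) = μ {ω | ∀ n, (X n ω, Z n ω) ∈ Cᶜ} := by
          refine measure_congr ?_
          filter_upwards [hΦXZ] with ω hω
          apply propext
          change (Φ ω).count C = 0 ↔ ∀ n, (X n ω, Z n ω) ∈ Cᶜ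
          simp [count_eq_zero_iff, hω]
      _ = ∫⁻ ω, ∏' n, ν (Prod.mk (X n ω) ⁻¹' Cᶜ) ∂μ :=
          measure_forall_marked_mem hX hZ hν hind hXZ (T := fun _ => Cᶜ) fun _ => hC.compl
      _ = _ := by
          refine lintegral_congr_ae ?_
          filter_upwards [hinj, hΨX] with ω h₁ h₂
          rw [tprod_eq_expNeg fun _ => prob_le_one]
          simp only [G]
          rw [lintegral_atomMeasure_of_range h₁ h₂ hl]
  have hterm : ∀ n, μ {ω | (X n ω, Z n ω) ∈ A ∧ ∀ m, (X m ω, Z m ω) ∉ C} =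
      ∫⁻ ω, g (X n ω, Ψ ω) ∂μ := by
    intro n
    let T : ℕ → Set (E × F) := fun m => if m = n then A else Cᶜ
    have hT : ∀ m, MeasurableSet (T m) := fun m => by
      by_cases h : m = n <;> simp [T, h, hA, hC]
    have hset : {ω | (X n ω, Z n ω) ∈ A ∧ ∀ m, (X m ω, Z m ω) ∉ C} =
        {ω | ∀ m, (X m ω, Z m ω) ∈ T m} := by
      ext ω
      constructor
      · rintro ⟨h₁, h₂⟩ m
        by_cases h : m = n
        · simpa [T, h] using h₁
        · simpa [T, h] using h₂ m
      · intro h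
        have hn : (X n ω, Z n ω) ∈ A := by simpa [T] using h n
        refine ⟨hn, fun m => ?_⟩
        by_cases hm : m = n
        -- The atom with index `n` lies in `A`, so it avoids `C` by disjointness.
        · rw [hm]; exact disjoint_left.1 hAC hn
        · simpa [T, hm] using h m
    rw [hset, measure_forall_marked_mem hX hZ hν hind hXZ hT]
    refine lintegral_congr_ae ?_
    filter_upwards [hinj, hΨX] with ω h₁ h₂
    rw [tprod_eq_expNeg fun _ => prob_le_one, ENNReal.tsum_eq_add_tsum_ite n, expNeg_add,
      expNeg_negLog prob_le_one]
    simp only [g]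
    rw [lintegral_atomMeasure_of_range h₁ h₂ (hl.indicator (measurableSet_singleton _).compl)]
    congr 2
    · simp [T]
    · refine tsum_congr fun m => ?_
      by_cases hm : m = n
      · simp [hm]
      · have : X m ω ≠ X n ω := fun h => hm (h₁ h)
        simp [T, hm, this, l]
  have hsum : ∫⁻ φ in {φ | φ.count C = 0}, φ.atomMeasure A ∂(μ.map Φ) =
      ∑' n, μ {ω | (X n ω, Z n ω) ∈ A ∧ ∀ m, (X m ω, Z m ω) ∉ C} := by
    have hmeas : ∀ n, MeasurableSet {ω | (X n ω, Z n ω) ∈ A ∧ ∀ m, (X m ω, Z m ω) ∉ C} := by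
      intro n
      have hXZm : ∀ m, Measurable fun ω => (X m ω, Z m ω) := fun m => (hX m).prodMk (hZ m)
      rw [ofPred_and, ofPred_forall]
      exact (hXZm n hA).inter (MeasurableSet.iInter fun m => hXZm m hC.compl)
    have hκ : Measurable fun φ : Configuration (E × F) => φ.atomMeasure A := by
      simp only [atomMeasure_apply _ hA]
      exact measurable_toENNReal_count hA
    rw [← lintegral_indicator hΓ, lintegral_map (hκ.indicator hΓ) hΦ]
    simp only [← lintegral_indicator_one (hmeas _)]
    rw [← lintegral_tsum fun n => (measurable_one.indicator (hmeas n)).aemeasurable]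
    refine lintegral_congr_ae ?_
    filter_upwards [hinj, hΦXZ] with ω h₁ h₂
    have h₃ : Function.Injective fun n => (X n ω, Z n ω) := fun i j hij =>
      h₁ (congrArg Prod.fst hij)
    have hc : (Φ ω).count C = 0 ↔ ∀ n, (X n ω, Z n ω) ∉ C := by
      simp [count_eq_zero_iff, h₂]
    by_cases h : (Φ ω).count C = 0
    · rw [indicator_of_mem (by exact h), ← lintegral_indicator_one hA,
        lintegral_atomMeasure_of_range h₃ h₂ (measurable_one.indicator hA)]
      refine tsum_congr fun n => ?_
      have hn : ω ∈ {ω | (X n ω, Z n ω) ∈ A ∧ ∀ m, (X m ω, Z m ω) ∉ C} ↔ (X n ω, Z n ω) ∈ A :=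
        and_iff_left (hc.1 h)
      by_cases hA' : (X n ω, Z n ω) ∈ A
      · rw [indicator_of_mem hA', indicator_of_mem (hn.2 hA')]
        rfl
      · rw [indicator_of_notMem hA', indicator_of_notMem (mt hn.1 hA')]
    · rw [indicator_of_notMem (by exact h)]
      have : ∀ n, ω ∉ {ω | (X n ω, Z n ω) ∈ A ∧ ∀ m, (X m ω, Z m ω) ∉ C} :=
        fun n hn => h (hc.2 hn.2)
      simp only [indicator_of_notMem (this _), tsum_zero]
  have hgX : ∀ n, Measurable fun ω => g (X n ω, Ψ ω) := fun n => hg.comp ((hX n).prodMk hΨ)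
  rw [hsum, hvoid, Measure.prod_apply hA, ← lintegral_mul_const _ hq]
  simp only [hterm]
  rw [← lintegral_tsum fun n => (hgX n).aemeasurable]
  calc ∫⁻ ω, ∑' n, g (X n ω, Ψ ω) ∂μ = ∫⁻ ω, ∫⁻ x, g (x, Ψ ω) ∂(Ψ ω).atomMeasure ∂μ := by
        refine lintegral_congr_ae ?_
        filter_upwards [hinj, hΨX] with ω h₁ h₂
        rw [lintegral_atomMeasure_of_range h₁ h₂ (h := fun x => g (x, Ψ ω))
          (hg.comp measurable_prodMk_right)]
    _ = ∫⁻ ψ, ∫⁻ x, g (x, ψ) ∂ψ.atomMeasure ∂(μ.map Ψ) := by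
        rw [lintegral_map (f := fun ψ => ∫⁻ x, g (x, ψ) ∂ψ.atomMeasure)
          (measurable_lintegral_atomMeasure measurable_id (hg.comp measurable_swap)) hΨ]
    _ = ∫⁻ x, ∫⁻ ψ, g (x, ψ.insertAtom x) ∂(μ.map Ψ) ∂M := H g hg
    _ = _ := by
        refine lintegral_congr fun x => ?_
        rw [← lintegral_const_mul _ hG]
        refine lintegral_congr_ae ?_
        -- The integral in `g` ignores the inserted `x`, and `ψ` almost surely has no atom there, so
        -- the exponential becomes `G ψ` and the integrand factorizes.
        filter_upwards [H.ae_notMem x] with ψ hψ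
        simp only [g]
        rw [lintegral_atomMeasure_insertAtom (hl.indicator (measurableSet_singleton _).compl)
          (by simp)]
        congr 2
        rw [lintegral_atomMeasure _ (hl.indicator (measurableSet_singleton _).compl),
          lintegral_atomMeasure _ hl]
        refine tsum_congr fun y => ?_
        have : (y : E) ≠ x := fun h => hψ (h ▸ y.2)
        simp [this]

end Configuration

/-! ### The hyperbolic distance and the region of a pair -/

instance : SigmaCompactSpace Mark := by
  have : LocallyCompactSpace Mark := isOpen_Ioi.locallyCompactSpace
  infer_instance

/-- The hyperbolic cosine of the hyperbolic distance. -/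
def coshDist (a b : HalfSpace) : ℝ :=
  dist a.1 b.1 ^ 2 / (2 * (a.2 : ℝ) * (b.2 : ℝ)) +
    1 / 2 * ((a.2 : ℝ) / (b.2 : ℝ) + (b.2 : ℝ) / (a.2 : ℝ))

theorem mark_pos (z : Mark) : (0 : ℝ) < z := z.2

/-- Cleared of denominators, comparisons of distances become polynomial inequalities. -/
theorem coshDist_mul (a b : HalfSpace) : 2 * (a.2 : ℝ) * b.2 * coshDist a b =
    dist a.1 b.1 ^ 2 + (a.2 : ℝ) ^ 2 + (b.2 : ℝ) ^ 2 := by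
  have ha := (mark_pos a.2).ne'
  have hb := (mark_pos b.2).ne'
  rw [coshDist]
  field_simp
  ring

theorem one_le_coshDist (a b : HalfSpace) : 1 ≤ coshDist a b := by
  have h := coshDist_mul a b
  have hpos : 0 < 2 * (a.2 : ℝ) * b.2 := by have := mark_pos a.2; have := mark_pos b.2; positivity
  refine le_of_mul_le_mul_left ?_ hpos
  nlinarith [sq_nonneg (dist a.1 b.1), sq_nonneg ((a.2 : ℝ) - b.2)]

theorem hypDist_eq (a b : HalfSpace) : hypDist a b = Real.arcosh (coshDist a b) := rfl

theorem cosh_hypDist (a b : HalfSpace) : Real.cosh (hypDist a b) = coshDist a b :=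
  Real.cosh_arcosh (one_le_coshDist a b)

theorem hypDist_nonneg (a b : HalfSpace) : 0 ≤ hypDist a b :=
  Real.arcosh_nonneg (one_le_coshDist a b)

theorem hypDist_lt_hypDist {a b c d : HalfSpace} :
    hypDist a b < hypDist c d ↔ coshDist a b < coshDist c d :=
  Real.arcosh_lt_arcosh (one_pos.trans_le (one_le_coshDist a b))
    (one_pos.trans_le (one_le_coshDist c d))

theorem coshDist_comm (a b : HalfSpace) : coshDist a b = coshDist b a := by
  rw [coshDist, coshDist, dist_comm, add_comm ((a.2 : ℝ) / b.2), mul_right_comm]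

theorem measurable_coshDist : Measurable fun p : HalfSpace × HalfSpace => coshDist p.1 p.2 := by
  unfold coshDist
  fun_prop

/-- Hyperbolic balls are Euclidean balls: expand the square of the vertical offset and use `cosh² =
sinh² + 1`. Nonnegativity of `R` makes the radius nonnegative, so squaring is reversible. -/
theorem mem_euclBall_iff (R : ℝ) (hR : 0 ≤ R) (a p : HalfSpace) :
    (p.1, (p.2 : ℝ)) ∈ euclBall R a ↔ coshDist a p < Real.cosh R := by
  have ha := mark_pos a.2
  have hp := mark_pos p.2
  have h := coshDist_mul a p
  have hpos : 0 < 2 * (a.2 : ℝ) * p.2 := by positivity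
  have hsq := Real.cosh_sq R
  rw [euclBall, mem_ofPred_eq, Real.sqrt_lt (by positivity)
    (mul_nonneg ha.le (Real.sinh_nonneg_iff.2 hR)),
    ← mul_lt_mul_iff_right₀ (b := coshDist a p) hpos, h, dist_comm]
  simp only
  have : ((a.2 : ℝ) * Real.cosh R) ^ 2 = (a.2 : ℝ) ^ 2 * Real.sinh R ^ 2 + (a.2 : ℝ) ^ 2 := by
    rw [mul_pow, hsq]; ring
  constructor <;> intro h' <;> nlinarith

theorem mem_pairRegion_iff {a b p : HalfSpace} :
    p ∈ pairRegion a b ↔ coshDist a p < coshDist a b ∨ coshDist b p < coshDist a b := by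
  rw [pairRegion, mem_ofPred_eq, mem_union, mem_euclBall_iff _ (hypDist_nonneg a b),
    mem_euclBall_iff _ (hypDist_nonneg a b), cosh_hypDist]

/-- The region of a pair with its boundary and without the two points. -/
def closedPairRegion (a b : HalfSpace) : Set HalfSpace :=
  {c | c ≠ a ∧ c ≠ b ∧ (coshDist a c ≤ coshDist a b ∨ coshDist b c ≤ coshDist a b)}

theorem measurableSet_closedPairRegion_prod :
    MeasurableSet {x : (HalfSpace × HalfSpace) × HalfSpace |
      x.2 ∈ closedPairRegion x.1.1 x.1.2} := by
  have hm : ∀ g : (HalfSpace × HalfSpace) × HalfSpace → HalfSpace × HalfSpace, Measurable g →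
      Measurable fun x => coshDist (g x).1 (g x).2 := fun g hg => measurable_coshDist.comp hg
  have h₁ := hm (fun x => (x.1.1, x.2)) (measurable_fst.fst.prodMk measurable_snd)
  have h₂ := hm (fun x => (x.1.2, x.2)) (measurable_fst.snd.prodMk measurable_snd)
  have h₃ := hm (fun x => x.1) measurable_fst
  have h₄ : MeasurableSet {x : (HalfSpace × HalfSpace) × HalfSpace | x.2 = x.1.1} :=
    measurableSet_eq_fun measurable_snd measurable_fst.fst
  have h₅ : MeasurableSet {x : (HalfSpace × HalfSpace) × HalfSpace | x.2 = x.1.2} :=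
    measurableSet_eq_fun measurable_snd measurable_fst.snd
  exact h₄.compl.inter (h₅.compl.inter ((measurableSet_le h₁ h₃).union (measurableSet_le h₂ h₃)))

theorem measurableSet_closedPairRegion (a b : HalfSpace) :
    MeasurableSet (closedPairRegion a b) :=
  (measurable_prodMk_left (x := (a, b))) measurableSet_closedPairRegion_prod

/-! ### Null spheres and finite mass of balls for the intensity measure -/

section intensity

variable (lam : ℝ≥0) (f : Mark → ℝ≥0)

instance : NullSingletonClass (lam • (volume : Measure Plane)) :=
  ⟨fun x => by simp⟩

instance : NullSingletonClass (intensity lam f) := by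
  unfold intensity
  infer_instance

instance [IsProbabilityMeasure (markLaw f)] : SigmaFinite (intensity lam f) := by
  unfold intensity
  infer_instance

/-- At each fixed height the slice lies in a Euclidean circle, possibly degenerate, which is null in
the plane. A negative radicand occurs only for an empty slice. -/
theorem intensity_sphere [IsProbabilityMeasure (markLaw f)] (a : HalfSpace) (r : ℝ) :
    intensity lam f {c | coshDist a c = r} = 0 := by
  have hm : MeasurableSet {c | coshDist a c = r} :=
    (measurable_coshDist.comp measurable_prodMk_left) (measurableSet_singleton r)
  rw [intensity, Measure.prod_apply_symm hm]
  refine lintegral_eq_zero_of_ae_eq_zero (Filter.Eventually.of_forall fun z => ?_)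
  have hsub : (fun x => (x, z)) ⁻¹' {c | coshDist a c = r} ⊆
      Metric.sphere a.1 (√(2 * a.2 * z * r - a.2 ^ 2 - z ^ 2)) := by
    intro x hx
    have hx' : coshDist a (x, z) = r := hx
    have h := coshDist_mul a (x, z)
    rw [hx'] at h
    have h' : 2 * a.2 * z * r - a.2 ^ 2 - z ^ 2 = dist a.1 x ^ 2 := by
      simp only at h
      linarith
    rw [Metric.mem_sphere, dist_comm, h', Real.sqrt_sq dist_nonneg]
  simp only [Pi.zero_apply, Measure.smul_apply]
  rw [measure_mono_null hsub (Measure.addHaar_sphere _ _ _), smul_zero]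

/-- The two regions differ only on two spheres and at two points, all null. -/
theorem intensity_closedPairRegion [IsProbabilityMeasure (markLaw f)]
    (a b : HalfSpace) :
    intensity lam f (closedPairRegion a b) = intensity lam f (pairRegion a b) := by
  have hne : ∀ x : HalfSpace, ∀ᵐ c ∂intensity lam f, c ≠ x := fun x => by simp [ae_iff]
  have hsph : ∀ x : HalfSpace, ∀ᵐ c ∂intensity lam f, coshDist x c ≠ coshDist a b := fun x => by
    simpa [ae_iff] using intensity_sphere lam f x (coshDist a b)
  refine measure_congr ?_
  filter_upwards [hne a, hne b, hsph a, hsph b] with c h₁ h₂ h₃ h₄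
  apply propext
  change c ∈ closedPairRegion a b ↔ c ∈ pairRegion a b
  rw [mem_pairRegion_iff, closedPairRegion, mem_ofPred_eq, h₃.le_iff_lt, h₄.le_iff_lt]
  tauto

/-- A hyperbolic ball has bounded planar projection and the marks have total mass one. Finiteness
matters because `toReal` would send `∞` to `0`. -/
theorem intensity_closedPairRegion_ne_top [IsProbabilityMeasure (markLaw f)] (a b : HalfSpace) :
    intensity lam f (closedPairRegion a b) ≠ ∞ := by
  have hball : ∀ x : HalfSpace, {c | coshDist x c ≤ coshDist a b} ⊆
      Metric.closedBall x.1 (2 * x.2 * coshDist a b) ×ˢ univ := by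
    intro x c hc
    have hc' : coshDist x c ≤ coshDist a b := hc
    have h := coshDist_mul x c
    have hx := mark_pos x.2
    have hz := mark_pos c.2
    have h1 := one_le_coshDist a b
    refine ⟨?_, trivial⟩
    rw [Metric.mem_closedBall, dist_comm]
    have h2 : 2 * (x.2 : ℝ) * c.2 * coshDist x c ≤ 2 * x.2 * c.2 * coshDist a b := by gcongr
    -- In `coshDist_mul` the term `c.2 ^ 2` alone bounds the height; inserted back, this bounds the
    -- squared planar distance by the square of the same constant.
    have h3 : (c.2 : ℝ) ≤ 2 * x.2 * coshDist a b := by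
      refine le_of_mul_le_mul_left ?_ hz
      nlinarith [sq_nonneg (dist x.1 c.1), sq_nonneg (x.2 : ℝ)]
    refine abs_le_of_sq_le_sq' ?_ (by positivity) |>.2
    have h4 : 2 * x.2 * c.2 * coshDist a b ≤
        (2 * x.2 * coshDist a b) * (2 * x.2 * coshDist a b) := by
      have : 0 ≤ 2 * x.2 * coshDist a b := by positivity
      nlinarith
    nlinarith [sq_nonneg (c.2 : ℝ), sq_nonneg (x.2 : ℝ)]
  have hfin : ∀ x : HalfSpace, intensity lam f {c | coshDist x c ≤ coshDist a b} ≠ ∞ := by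
    intro x
    refine ne_top_of_le_ne_top ?_ (measure_mono (hball x))
    rw [intensity, Measure.prod_prod, measure_univ, mul_one, Measure.smul_apply]
    exact ENNReal.mul_ne_top ENNReal.coe_ne_top measure_closedBall_lt_top.ne
  refine ne_top_of_le_ne_top (ENNReal.add_ne_top.2 ⟨hfin a, hfin b⟩)
    ((measure_mono fun c hc => ?_).trans (measure_union_le _ _))
  exact hc.2.2

end intensity

/-! ### The mutually nearest neighbor relation -/

/-- Uniqueness of the nearest neighbors forbids ties, so the void region must contain the boundary
spheres. -/
theorem MNNR_iff {D : Set (Mark × Mark)} {φ : Configuration HalfSpace} {a b : HalfSpace} :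
    MNNR D φ a b ↔ a ∈ φ.atoms ∧ b ∈ φ.atoms ∧ a ≠ b ∧ (a.2, b.2) ∈ D ∧
      φ.count (closedPairRegion a b) = 0 := by
  rw [Configuration.count_eq_zero_iff]
  simp only [MNNR, NNR, hypDist_lt_hypDist, closedPairRegion, mem_ofPred_eq, coshDist_comm b a]
  constructor
  · rintro ⟨⟨ha, hb, hab, h⟩, ⟨-, -, -, h'⟩, hD⟩
    refine ⟨ha, hb, hab, hD, fun c hc ⟨hca, hcb, hle⟩ => ?_⟩
    rcases hle with hle | hle
    · exact absurd (h c hc hca hcb) hle.not_gt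
    · exact absurd (h' c hc hcb hca) hle.not_gt
  · rintro ⟨ha, hb, hab, hD, h⟩
    refine ⟨⟨ha, hb, hab, fun c hc hca hcb => ?_⟩, ⟨hb, ha, hab.symm, fun c hc hcb hca => ?_⟩, hD⟩
    · exact not_le.1 fun hle => h c hc ⟨hca, hcb, Or.inl hle⟩
    · exact not_le.1 fun hle => h c hc ⟨hca, hcb, Or.inr hle⟩

theorem MNNR_insertAtom_iff {D : Set (Mark × Mark)} {φ : Configuration HalfSpace}
    {a b : HalfSpace} (hab : a ≠ b) :
    MNNR D ((φ.insertAtom b).insertAtom a) a b ↔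
      (a.2, b.2) ∈ D ∧ φ.count (closedPairRegion a b) = 0 := by
  rw [MNNR_iff, Configuration.count_insertAtom_eq_zero_iff,
    Configuration.count_insertAtom_eq_zero_iff]
  have ha : a ∉ closedPairRegion a b := fun h => h.1 rfl
  have hb : b ∉ closedPairRegion a b := fun h => h.2.1 rfl
  simp [Configuration.mem_insertAtom, hab, ha, hb]

/-- The count of a section that varies with the parameter is an integral against the atom kernel,
hence jointly measurable. -/
theorem measurableSet_count_section_eq_zero {α : Type*} [MeasurableSpace α]
    {W : Set (α × HalfSpace)} (hW : MeasurableSet W) :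
    MeasurableSet {q : α × Configuration HalfSpace | q.2.count (Prod.mk q.1 ⁻¹' W) = 0} := by
  have hm : Measurable fun x : (α × Configuration HalfSpace) × HalfSpace =>
      W.indicator (1 : α × HalfSpace → ℝ≥0∞) (x.1.1, x.2) :=
    (measurable_one.indicator hW).comp (by fun_prop)
  have := Configuration.measurable_lintegral_atomMeasure
    (measurable_snd : Measurable (Prod.snd : α × Configuration HalfSpace → _)) hm
  convert this (measurableSet_singleton 0) using 1
  ext q
  have hq : ∫⁻ c, W.indicator (1 : α × HalfSpace → ℝ≥0∞) (q.1, c) ∂q.2.atomMeasure =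
      (q.2.count (Prod.mk q.1 ⁻¹' W) : ℝ≥0∞) := by
    rw [← Configuration.atomMeasure_apply _ (measurable_prodMk_left hW),
      ← lintegral_indicator_one (measurable_prodMk_left hW)]
    rfl
  simp [hq]

theorem measurableSet_MNNR {D : Set (Mark × Mark)} (hD : MeasurableSet D) :
    MeasurableSet {q : (HalfSpace × HalfSpace) × Configuration HalfSpace |
      MNNR D q.2 q.1.1 q.1.2} := by
  have hmem : ∀ g : HalfSpace × HalfSpace → HalfSpace, Measurable g →
      MeasurableSet {q : (HalfSpace × HalfSpace) × Configuration HalfSpace |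
        g q.1 ∈ q.2.atoms} := by
    intro g hg
    have hW : MeasurableSet {x : (HalfSpace × HalfSpace) × HalfSpace | x.2 = g x.1} :=
      measurableSet_eq_fun measurable_snd (hg.comp measurable_fst)
    convert (measurableSet_count_section_eq_zero hW).compl using 1
    ext q
    change g q.1 ∈ q.2.atoms ↔ ¬ q.2.count {c | c = g q.1} = 0
    rw [Configuration.count_eq_zero_iff]
    push Not
    exact ⟨fun h => ⟨_, h, rfl⟩, fun ⟨c, hc, hcg⟩ => (show c = g q.1 from hcg) ▸ hc⟩
  have hD' : MeasurableSet {q : (HalfSpace × HalfSpace) × Configuration HalfSpace |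
      (q.1.1.2, q.1.2.2) ∈ D} :=
    (by fun_prop : Measurable fun q : (HalfSpace × HalfSpace) × Configuration HalfSpace =>
      (q.1.1.2, q.1.2.2)) hD
  simp only [MNNR_iff]
  exact (hmem _ measurable_fst).inter ((hmem _ measurable_snd).inter
    ((measurableSet_eq_fun (by fun_prop) (by fun_prop)).compl.inter
      (hD'.inter (measurableSet_count_section_eq_zero measurableSet_closedPairRegion_prod))))

/-! ### The Palm probability of the relation -/

theorem IsMarkedPoisson.isMecke {Ω : Type*} [MeasurableSpace Ω] {μ : Measure Ω}
    [IsProbabilityMeasure μ] {lam : ℝ≥0} {f : Mark → ℝ≥0} [IsProbabilityMeasure (markLaw f)]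
    {Φ : Ω → Configuration HalfSpace} (h : IsMarkedPoisson μ lam f Φ) :
    Configuration.IsMecke (intensity lam f) (μ.map Φ) := by
  obtain ⟨Ψ, X, Z, hΨ, hX, hZ, hinj, hΨX, hν, hind, hXZ, hΦ⟩ := h.exists_marking
  exact hΨ.isMecke.marked hΨ.measurable h.measurable hX hZ hinj hΨX hν hind hXZ hΦ

/-- After insertion of `a` and `b` the relation is a condition on the heights together with a void
event of the original process. -/
theorem twoFoldKernel_MNNR {ρ : Measure (Configuration HalfSpace)} [IsProbabilityMeasure ρ]
    {lam : ℝ≥0} {f : Mark → ℝ≥0} [IsProbabilityMeasure (markLaw f)]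
    (H : Configuration.IsMecke (intensity lam f) ρ) {D : Set (Mark × Mark)}
    (hD : MeasurableSet D) {a b : HalfSpace} (hab : a ≠ b) :
    Configuration.twoFoldKernel ρ (a, b) {φ | MNNR D φ a b} =
      ENNReal.ofReal (Real.exp (-(intensity lam f (pairRegion a b)).toReal)) *
        D.indicator 1 (a.2, b.2) := by
  have hS : MeasurableSet {φ : Configuration HalfSpace | MNNR D φ a b} :=
    (measurable_prodMk_left (x := (a, b))) (measurableSet_MNNR hD)
  rw [Configuration.twoFoldKernel_apply,
    Measure.map_apply (Configuration.measurable_insertAtom_insertAtom a b) hS]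
  simp only [preimage_ofPred_eq, MNNR_insertAtom_iff hab]
  by_cases h : (a.2, b.2) ∈ D
  · simp only [h, true_and, indicator_of_mem, Pi.one_apply, mul_one]
    rw [H.measure_void (measurableSet_closedPairRegion a b)
      (intensity_closedPairRegion_ne_top lam f a b), intensity_closedPairRegion]
  · simp [h]

end

theorem proposition2 {Ω : Type*} [MeasurableSpace Ω] (μ : Measure Ω) [IsProbabilityMeasure μ]
    (lam : ℝ≥0) (hlam : 0 < lam)
    (f : Mark → ℝ≥0) (hf : Measurable f) (hf1 : IsProbabilityMeasure (markLaw f))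
    (D : Set (Mark × Mark)) (hD : MeasurableSet D) (hDsymm : ∀ z w, (z, w) ∈ D → (w, z) ∈ D)
    (Φ : Ω → Configuration HalfSpace) (hΦ : IsMarkedPoisson μ lam f Φ) :
    (∀ P : Kernel (HalfSpace × HalfSpace) (Configuration HalfSpace), IsTwoFoldPalm μ Φ P →
      ∀ᵐ p ∂(secondFactorialMoment μ Φ),
        P p {φ | MNNR D φ p.1 p.2} =
          ENNReal.ofReal (Real.exp (-(intensity lam f (pairRegion p.1 p.2)).toReal)) *
            D.indicator 1 (p.1.2, p.2.2)) ∧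
    (∃ P : Kernel (HalfSpace × HalfSpace) (Configuration HalfSpace), IsTwoFoldPalm μ Φ P ∧
      ∀ a b : HalfSpace, a ≠ b →
        P (a, b) {φ | MNNR D φ a b} =
          ENNReal.ofReal (Real.exp (-(intensity lam f (pairRegion a b)).toReal)) *
            D.indicator 1 (a.2, b.2)) := by
  have hM := hΦ.isMecke
  have := Measure.isProbabilityMeasure_map (μ := μ) hΦ.measurable.aemeasurable
  have hQ := hM.isTwoFoldPalm hΦ.measurable
  have hM2 := hM.secondFactorialMoment_eq hΦ.measurable
  refine ⟨fun P hP => ?_, _, hQ, fun a b hab => twoFoldKernel_MNNR hM hD hab⟩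
  have : SigmaFinite (secondFactorialMoment μ Φ) := by
    rw [hM2]
    infer_instance
  -- The explicit kernel is evaluated only off the diagonal, which is null for the product of two
  -- measures without atoms.
  have hdiag : ∀ᵐ p ∂secondFactorialMoment μ Φ, p.1 ≠ p.2 := by
    rw [hM2, ae_iff]
    simp only [not_not]
    rw [Measure.measure_prod_null (measurableSet_eq_fun measurable_fst measurable_snd)]
    refine Filter.Eventually.of_forall fun a => ?_
    simp [preimage]
  filter_upwards [hP.ae_eq hQ (measurableSet_MNNR hD), hdiag] with p hp hne
  exact hp.trans (twoFoldKernel_MNNR hM hD hne)
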